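/- **Setting.** A *spherical ensemble* on $\Sigma^*$ ($\Sigma$ a finite ordered alphabet) is a family $\mu=(\mu_n)_{n\ge 0}$ of probability measures $\mu_n$ on $\Sigma^n$; a *distributional problem* is a pair $(D,\mu)$ with $D\subseteq\Sigma^*$. Put $\mu^*(x)=\mu_{|x|}\{y\in\Sigma^{|x|}: y<_{slex}x\}$, where $<_{slex}$ is the shortlex order. The problem $(D,\mu)$ is in $\mathbf{DistNP}$ if $D\in\mathbf{NP}$ and $\mu^*$ is polynomial time computable, i.e. some deterministic Turing machine computes from every $x$ and $k$, in time polynomial in $|x|+k$, a binary fraction at distance less than $2^{-k}$ from $\mu^*(x)$. A deterministic Turing machine $A$ *partially decides* $D$ if on every input it answers Yes or No correctly or gives no answer (it does not halt, breaks, or says DontKnow); $T_A(x)\in\mathbb N\cup\{\infty\}$ is its running time, $\infty$ if there is no answer. $A$ *SGPtime decides* $(D,\mu)$ if it partially decides $D$ and there is a polynomial $p$ such that $\mu_n\{x\in\Sigma^n: T_A(x)>p(n)\}=o(1/q(n))$ for every nonzero polynomial $q$ (with coefficients in $\mathbb N$). For $(D,\mu),(E,\nu)\in\mathbf{DistNP}$,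 an *SGPtime reduction* $(D,\mu)\xrightarrow{f}(E,\nu)$ is a polynomial time computable function $f$ such that $x\in D\iff f(x)\in E$, such that $|x_1|<|x_2|\iff|f(x_1)|<|f(x_2)|$, and such that for every Turing machine $A$ that SGPtime decides $(E,\nu)$ the composition $A\circ f$ (run any polynomial time Turing machine that computes $f$, then run $A$ on its output) SGPtime decides $(D,\mu)$. For $S\subseteq\Sigma^*$ the $S$-*induced* ensemble $\mu^S$ is given by $\mu^S_n(x)=\mu_n(\{x\}\cap S)/\mu_n(S\cap\Sigma^n)$ if $\mu_n(S\cap\Sigma^n)\ne0$, and $\mu^S_n(x)=\mu_n(x)$ otherwise ($n=|x|$). Let $M$ be a one-tape nondeterministic Turing machine with tape alphabet $\{0,1\}$. Let $BH(M)^+$ be the set of the words $u=1^m0w$ ($m\ge0$, $w\in\{0,1\}^*$) such that some computation of $M$ on $w$ halts within $|u|$ steps. Let $\nu$ be the ensemble on $\{0,1\}^*$ with $\nu_{|u|}(u)=\frac1{|u|\,2^{|w|}}$ for $u=1^m0w$, $\nu_0(\varepsilon)=1$, and $\nu_k(1^k)=0$ for $k\ge1$. Put $DBH(M)=(BH(M)^+,\nu)$.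 For $g:\mathbb N\to\mathbb N$ let $C(g)$ be the set of the words $u=1^m0w$ with $|u|=g(|w|)$, and put $DBH(M,g)=(BH(M)^+,\nu^{C(g)})$. **Proposition.** Let $M$ be a nondeterministic Turing machine with tape alphabet $\{0,1\}$, and let $g:\mathbb N\to\mathbb N$ be a strictly increasing polynomial function with $g(n)\ge n$ for all $n$. Then $DBH(M,g)\in\mathbf{DistNP}$, and the identity map of $\{0,1\}^*$ is an SGPtime reduction $DBH(M,g)\to DBH(M)$. -/

import Mathlib

open Filter Asymptotics

noncomputable section

namespace GenericNP

/-! ### The nondeterministic Turing machines of the bounded halting problem -/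

/-- A one-tape nondeterministic Turing machine with tape alphabet `α`. A cell contains `none`
(the blank) or a symbol of `α`. `δ q a q' a' d` says that `(q, a, q', a', d)` is in the transition
relation; the blank can be read but not written. -/
structure NTM (α : Type) where
  Q : Type
  [finQ : Finite Q]
  start : Q
  halt : Q
  δ : Q → Option α → Q → α → Turing.Dir → Prop

namespace NTM

variable {α : Type} (M : NTM α)

/-- One step of computation, on configurations (state, tape with head). -/
def Step (c c' : M.Q × Turing.Tape (Option α)) : Prop :=
  ∃ a d, M.δ c.1 c.2.head c'.1 a d ∧ c'.2 = (c.2.write (some a)).move d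

/-- "Yields in `n` steps". -/
def ReachesIn : ℕ → M.Q × Turing.Tape (Option α) → M.Q × Turing.Tape (Option α) → Prop
  | 0, c, c' => c = c'
  | n + 1, c, c' => ∃ e, M.Step c e ∧ ReachesIn n e c'

/-- Some computation of `M` on the input `w` is in the halting state after at most `n` steps. -/
def HaltsWithin (w : List α) (n : ℕ) : Prop :=
  ∃ m ≤ n, ∃ T, M.ReachesIn m (M.start, Turing.Tape.mk₁ (w.map some)) (M.halt, T)

end NTM

/-! ### Multi-tape Turing machines as algorithms -/

/-- A nondeterministic multi-tape Turing machine that reads words over `α` and writes words over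
`β`. The tapes are indexed by the finite type `ι`, the tape alphabet is the finite type `Γ`, and a
cell contains `none` (the blank) or a symbol of `Γ`.
`δ q r q' w d` says that in state `q`, when the heads read the symbols `r`, the machine may go to
state `q'`, write the symbols `w` and move the heads as `d` says (`none` means: do not move). -/
structure MTM (α β : Type) where
  ι : Type
  [finι : Finite ι]
  inTape : ι
  outTape : ι
  Γ : Type
  [finΓ : Finite Γ]
  inp : α ↪ Γ
  out : β ↪ Γ
  Q : Type
  [finQ : Finite Q]
  start : Q
  halt : Q
  δ : Q → (ι → Option Γ) → Q → (ι → Option Γ) → (ι → Option Turing.Dir) → Prop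

attribute [instance] NTM.finQ MTM.finι MTM.finΓ MTM.finQ

/-- Move the head of a tape, or leave it where it is. -/
def moveTape {Γ : Type} [Inhabited Γ] : Option Turing.Dir → Turing.Tape Γ → Turing.Tape Γ
  | none, T => T
  | some d, T => T.move d

namespace MTM

variable {α β γ : Type} (M : MTM α β)

/-- A configuration: the state and the tapes with their heads. -/
structure Cfg where
  state : M.Q
  tape : M.ι → Turing.Tape (Option M.Γ)

open Classical in
/-- The initial configuration on input `x`: the head of the input tape is on the first letter
of `x`, all other cells of all tapes are blank. -/
def init (x : List α) : M.Cfg where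
  state := M.start
  tape i := Turing.Tape.mk₁ (if i = M.inTape then x.map fun a => some (M.inp a) else [])

/-- One step of computation. There is none from the halting state. -/
def Step (c c' : M.Cfg) : Prop :=
  c.state ≠ M.halt ∧ ∃ w d, M.δ c.state (fun i => (c.tape i).head) c'.state w d ∧
    ∀ i, c'.tape i = moveTape (d i) ((c.tape i).write (w i))

/-- "Yields in `n` steps". -/
def ReachesIn : ℕ → M.Cfg → M.Cfg → Prop
  | 0, c, c' => c = c'
  | n + 1, c, c' => ∃ e, M.Step c e ∧ ReachesIn n e c'

/-- Some computation of `M` on input `x` halts after exactly `n` steps with output `y`: the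
output tape carries `y`, followed by blanks only, from the position of its head to the right. -/
def OutputsIn (x : List α) (n : ℕ) (y : List β) : Prop :=
  ∃ c, M.ReachesIn n (M.init x) c ∧ c.state = M.halt ∧
    (c.tape M.outTape).right₀ = Turing.ListBlank.mk (y.map fun b => some (M.out b))

/-- At most one transition applies in every situation. -/
def Deterministic : Prop :=
  ∀ q r q₁ w₁ d₁ q₂ w₂ d₂, M.δ q r q₁ w₁ d₁ → M.δ q r q₂ w₂ d₂ → q₁ = q₂ ∧ w₁ = w₂ ∧ d₁ = d₂

/-- `M` is a deterministic Turing machine that computes `f` in polynomial time. -/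
def ComputesInPolyTime (f : List α → List β) : Prop :=
  M.Deterministic ∧ ∃ p : Polynomial ℕ, ∀ x, ∃ n ≤ p.eval x.length, M.OutputsIn x n (f x)

/-- Some computation of `M` on `x` halts after exactly `n` steps with the answer `b`. The answer
is Yes (`true`) if the output starts with `11` and No (`false`) if it starts with `10`. All other
outputs mean DontKnow. -/
def AnswersIn (M : MTM α Bool) (x : List α) (n : ℕ) (b : Bool) : Prop :=
  ∃ y, M.OutputsIn x n (true :: b :: y)

/-- The running time `T_M(x)` of a deterministic machine; it is `∞` if `M` does not halt on `x`,
breaks, or answers DontKnow. -/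
def time (M : MTM α Bool) (x : List α) : ℕ∞ :=
  ⨅ (n : ℕ) (_ : ∃ b, M.AnswersIn x n b), (n : ℕ∞)

/-- `M` is a deterministic Turing machine, and on each input it answers correctly whether the
input is in `L`, or it gives no answer (it does not halt, breaks, or says DontKnow). -/
def PartiallyDecides (M : MTM α Bool) (L : Set (List α)) : Prop :=
  M.Deterministic ∧ ∀ x n b, M.AnswersIn x n b → (b = true ↔ x ∈ L)

/-- The nondeterministic machine `M` decides `L` in polynomial time: `x ∈ L` if and only if some
computation on `x` says Yes, and every computation on `x` has at most `p(|x|)` steps. -/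
def NDecidesInPolyTime (M : MTM α Bool) (L : Set (List α)) : Prop :=
  ∃ p : Polynomial ℕ, ∀ x, (x ∈ L ↔ ∃ n, M.AnswersIn x n true) ∧
    ∀ n c, M.ReachesIn n (M.init x) c → n ≤ p.eval x.length

/-- The transitions of the composition of `F` and `M`. -/
inductive CompStep (F : MTM α β) (M : MTM β γ) :
    F.Q ⊕ Unit ⊕ M.Q → (F.ι ⊕ M.ι → Option (F.Γ ⊕ M.Γ)) →
    F.Q ⊕ Unit ⊕ M.Q → (F.ι ⊕ M.ι → Option (F.Γ ⊕ M.Γ)) → (F.ι ⊕ M.ι → Option Turing.Dir) → Prop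
  /-- Run `F` on its tapes. -/
  | first {q q' r w d} (rM : M.ι → Option (F.Γ ⊕ M.Γ)) (hq : q ≠ F.halt) (h : F.δ q r q' w d) :
      CompStep F M (.inl q) (Sum.elim (fun i => (r i).map Sum.inl) rM)
        (.inl q') (Sum.elim (fun i => (w i).map Sum.inl) rM) (Sum.elim d fun _ => none)
  /-- When `F` has halted, copy its output, letter by letter, to the input tape of `M`. -/
  | copy (r : F.ι ⊕ M.ι → Option (F.Γ ⊕ M.Γ)) (b : β)
      (hr : r (.inl F.outTape) = some (.inl (F.out b))) :
      CompStep F M (.inl F.halt) r (.inl F.halt)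
        (open Classical in Function.update r (.inr M.inTape) (some (.inr (M.inp b))))
        (open Classical in fun i =>
          if i = .inl F.outTape ∨ i = .inr M.inTape then some .right else none)
  /-- At the end of the output of `F`, turn round on the input tape of `M`. -/
  | turn (r : F.ι ⊕ M.ι → Option (F.Γ ⊕ M.Γ)) (hr : r (.inl F.outTape) = none) :
      CompStep F M (.inl F.halt) r (.inr (.inl ())) r
        (open Classical in fun i => if i = .inr M.inTape then some .left else none)
  /-- Rewind the input tape of `M`. -/
  | rewind (r : F.ι ⊕ M.ι → Option (F.Γ ⊕ M.Γ)) (hr : r (.inr M.inTape) ≠ none) :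
      CompStep F M (.inr (.inl ())) r (.inr (.inl ())) r
        (open Classical in fun i => if i = .inr M.inTape then some .left else none)
  /-- At the blank before the word on the input tape of `M`, start `M` on that word. -/
  | launch (r : F.ι ⊕ M.ι → Option (F.Γ ⊕ M.Γ)) (hr : r (.inr M.inTape) = none) :
      CompStep F M (.inr (.inl ())) r (.inr (.inr M.start)) r
        (open Classical in fun i => if i = .inr M.inTape then some .right else none)
  /-- Run `M` on its tapes. -/
  | second {q q' r w d} (rF : F.ι → Option (F.Γ ⊕ M.Γ)) (h : M.δ q r q' w d) :
      CompStep F M (.inr (.inr q)) (Sum.elim rF fun i => (r i).map Sum.inr)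
        (.inr (.inr q')) (Sum.elim rF fun i => (w i).map Sum.inr) (Sum.elim (fun _ => none) d)

/-- The composition `M ∘ F`: run `F`, then run `M` on the output of `F`. -/
abbrev comp (M : MTM β γ) (F : MTM α β) : MTM α γ where
  ι := F.ι ⊕ M.ι
  inTape := .inl F.inTape
  outTape := .inr M.outTape
  Γ := F.Γ ⊕ M.Γ
  inp := F.inp.trans Function.Embedding.inl
  out := M.out.trans Function.Embedding.inr
  Q := F.Q ⊕ Unit ⊕ M.Q
  start := .inl F.start
  halt := .inr (.inr M.halt)
  δ := CompStep F M

end MTM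

/-- The class `NP` over the alphabet `α`. -/
def InNP {α : Type} (L : Set (List α)) : Prop :=
  ∃ N : MTM α Bool, N.NDecidesInPolyTime L

/-- The real number `0.b₁b₂…bⱼ` in binary notation. -/
def binFrac : List Bool → ℝ
  | [] => 0
  | b :: l => ((if b then 1 else 0) + binFrac l) / 2

/-- `φ` is computable in polynomial time: some deterministic Turing machine computes from every
word `x` and every `k`, given in unary, a binary fraction that differs from `φ x` by less than
`2⁻ᵏ`, in a time polynomial in `|x| + k`. -/
def PtimeComputableReal {α : Type} (φ : List α → ℝ) : Prop :=
  ∃ F : MTM (Option α) Bool, F.Deterministic ∧ ∃ p : Polynomial ℕ, ∀ x k,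
    ∃ n ≤ p.eval (x.length + k), ∃ y,
      F.OutputsIn (x.map some ++ List.replicate k none) n y ∧ |φ x - binFrac y| < (1 / 2) ^ k

/-! ### Distributional problems -/

/-- The sum of `f` over the words of length `n` that belong to `S`. -/
def sphereSum {α : Type} [Fintype α] (f : List α → ℝ) (n : ℕ) (S : Set (List α)) : ℝ :=
  ∑ v : Fin n → α, S.indicator f (List.ofFn v)

/-- A spherical ensemble of probability measures `μ_n` on the sets of words of length `n`,
given by the probability functions: `prob x` is `μ_{|x|}(x)`. -/
structure Ensemble (α : Type) [Fintype α] where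
  prob : List α → ℝ
  nonneg : ∀ x, 0 ≤ prob x
  total : ∀ n, sphereSum prob n Set.univ = 1

namespace Ensemble

variable {α : Type} [Fintype α] (μ : Ensemble α)

/-- `μ_n(S)`, the measure of the set of the words of length `n` in `S`. -/
def measure (n : ℕ) (S : Set (List α)) : ℝ := sphereSum μ.prob n S

/-- The distribution function `μ*`: the measure of the set of the words of length `|x|` that
precede `x` in the shortlex ordering. -/
def distribution [LinearOrder α] (x : List α) : ℝ :=
  μ.measure x.length {y | List.Shortlex (· < ·) y x}

open Classical in
/-- The ensemble that is `S`-induced by `μ`. -/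
def induced (S : Set (List α)) : Ensemble α where
  prob x :=
    if μ.measure x.length S ≠ 0 then S.indicator μ.prob x / μ.measure x.length S else μ.prob x
  nonneg x := by
    have h : ∀ y, 0 ≤ S.indicator μ.prob y := fun y => Set.indicator_nonneg (fun z _ => μ.nonneg z) y
    split_ifs
    · exact div_nonneg (h x) (Finset.sum_nonneg fun v _ => h _)
    · exact μ.nonneg x
  total n := by
    have ht := μ.total n
    by_cases h : μ.measure n S = 0
    · simpa [sphereSum, h] using ht
    · simp only [sphereSum, Set.indicator_univ, List.length_ofFn, ne_eq, h, not_false_eq_true,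
        if_true, ← Finset.sum_div]
      exact div_self h

end Ensemble

/-- A distributional decision problem `(α*, D⁺, μ)`; `yes` is `D⁺`. -/
structure DistProblem (α : Type) [Fintype α] where
  yes : Set (List α)
  μ : Ensemble α

/-- The restriction of a distributional problem to `S`: same problem, `S`-induced ensemble. -/
def DistProblem.restrict {α : Type} [Fintype α] (D : DistProblem α) (S : Set (List α)) :
    DistProblem α where
  yes := D.yes
  μ := D.μ.induced S

/-- The class `DistNP`. -/
def InDistNP {α : Type} [Fintype α] [LinearOrder α] (D : DistProblem α) : Prop :=
  InNP D.yes ∧ PtimeComputableReal D.μ.distribution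

/-- The Turing machine `M` decides `D` strongly generically in polynomial time. -/
def SGPtimeDecides {α : Type} [Fintype α] (M : MTM α Bool) (D : DistProblem α) : Prop :=
  M.PartiallyDecides D.yes ∧ ∃ p : Polynomial ℕ, ∀ q : Polynomial ℕ, q ≠ 0 →
    (fun n => D.μ.measure n {x | ((p.eval n : ℕ) : ℕ∞) < M.time x}) =o[atTop]
      fun n => 1 / ((q.eval n : ℕ) : ℝ)

/-- `f` is a size-invariant polynomial time (Karp) reduction of `L` to `K`. -/
structure IsSizeInvariantPtimeReduction {α β : Type} (f : List α → List β)
    (L : Set (List α)) (K : Set (List β)) : Prop where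
  computable : ∃ F : MTM α β, F.ComputesInPolyTime f
  mem_iff : ∀ x, x ∈ L ↔ f x ∈ K
  size_invariant : ∀ x₁ x₂, x₁.length < x₂.length ↔ (f x₁).length < (f x₂).length

/-- `f` is an SGPtime reduction of the `DistNP` problem `D` to the `DistNP` problem `E`: it is a
size-invariant Ptime reduction, and whenever `M` SGPtime decides `E`, the composition of `M` with
any machine that computes `f` in polynomial time SGPtime decides `D`. -/
structure IsSGPtimeReduction {α β : Type} [Fintype α] [LinearOrder α] [Fintype β] [LinearOrder β]
    (f : List α → List β) (D : DistProblem α) (E : DistProblem β) : Prop where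
  source : InDistNP D
  target : InDistNP E
  reduction : IsSizeInvariantPtimeReduction f D.yes E.yes
  comp_decides : ∀ F : MTM α β, F.ComputesInPolyTime f →
    ∀ M : MTM β Bool, SGPtimeDecides M E → SGPtimeDecides (M.comp F) D

/-! ### The distributional bounded halting problem -/

/-- The word `1^m 0 w`, which encodes the pair `(n, w)` for `n = m + 1 + |w|`. -/
def code (m : ℕ) (w : List Bool) : List Bool := List.replicate m true ++ false :: w

/-- The positive part of the bounded halting problem `BH(M)`. -/
def boundedHalting (M : NTM Bool) : Set (List Bool) :=
  {u | ∃ m w, u = code m w ∧ M.HaltsWithin w u.length}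

/-- The probability function of the ensemble `ν`: it is `1 / (|u| 2^|w|)` at `u = 1^m 0 w`,
`1` at the empty word, and `0` at `1^k` for `k ≥ 1`. -/
def haltingProb (u : List Bool) : ℝ :=
  match u.dropWhile id with
  | _ :: w => 1 / (u.length * 2 ^ w.length)
  | [] => if u = [] then 1 else 0

theorem haltingProb_code (m : ℕ) (w : List Bool) :
    haltingProb (code m w) = 1 / ((code m w).length * 2 ^ w.length) := by
  have h : (code m w).dropWhile id = false :: w := by
    unfold code
    induction m with
    | zero => rfl
    | succ m ih => simp [List.replicate_succ]
  simp only [haltingProb, h]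

/-- The weight `1 / 2^|w|` of a word `1^m 0 w`. -/
def haltingWeight (u : List Bool) : ℝ :=
  match u.dropWhile id with
  | _ :: w => 1 / 2 ^ w.length
  | [] => 0

theorem sum_haltingWeight (n : ℕ) : ∑ v : Fin n → Bool, haltingWeight (List.ofFn v) = n := by
  induction n with
  | zero => simp [haltingWeight]
  | succ n ih =>
    rw [← (Fin.consEquiv fun _ : Fin (n + 1) => Bool).sum_comp, Fintype.sum_prod_type,
      Fintype.sum_bool]
    have h1 : ∀ v : Fin n → Bool,
        haltingWeight (List.ofFn ((Fin.consEquiv fun _ : Fin (n + 1) => Bool) (true, v))) =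
          haltingWeight (List.ofFn v) := by
      intro v
      simp [haltingWeight, Fin.consEquiv]
    have h2 : ∀ v : Fin n → Bool,
        haltingWeight (List.ofFn ((Fin.consEquiv fun _ : Fin (n + 1) => Bool) (false, v))) =
          1 / 2 ^ n := by
      intro v
      simp [haltingWeight, Fin.consEquiv]
    simp only [h1, h2, ih]
    simp

/-- The ensemble `ν` of the distributional bounded halting problem. -/
def haltingEnsemble : Ensemble Bool where
  prob := haltingProb
  nonneg u := by
    unfold haltingProb
    split
    · positivity
    · split_ifs <;> norm_num
  total n := by
    rcases Nat.eq_zero_or_pos n with rfl | hn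
    · simp [sphereSum, haltingProb]
    · have hn' : (n : ℝ) ≠ 0 := by positivity
      have key : ∀ v : Fin n → Bool,
          haltingProb (List.ofFn v) = haltingWeight (List.ofFn v) / n := by
        intro v
        have hne : List.ofFn v ≠ [] := by
          intro h
          have := congrArg List.length h
          simp at this
          omega
        unfold haltingProb haltingWeight
        split
        · rw [List.length_ofFn, mul_comm, div_div]
        · simp [hne]
      simp only [sphereSum, Set.indicator_univ, key]
      rw [← Finset.sum_div, sum_haltingWeight, div_self hn']

/-- The distributional bounded halting problem `DBH(M)`. -/
def DBH (M : NTM Bool) : DistProblem Bool where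
  yes := boundedHalting M
  μ := haltingEnsemble

/-- The set `C(g)` of the codes of the pairs `(g(|w|), w)`. -/
def guardedCodes (g : ℕ → ℕ) : Set (List Bool) :=
  {u | ∃ m w, u = code m w ∧ u.length = g w.length}

/-- The restriction `DBH(M, g)` of `DBH(M)` to `C(g)`. -/
def restrictedDBH (M : NTM Bool) (g : ℕ → ℕ) : DistProblem Bool :=
  (DBH M).restrict (guardedCodes g)

end GenericNP

end

/-!
# Restrictions of the distributional bounded halting problem

*The problem is in `NP`.* A nondeterministic machine reads `u = 1^m 0 w`, winds up a clock with
one mark for each letter of `u`, and then simulates `M` on `w`, paying one mark for each step; it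
accepts if the simulation halts (`clocked`, `boundedHalting_inNP`). On a word without a zero it
gets stuck.

*The distribution function.* Let `n = |u|` and `u = 1^m 0 w`. A word of length `n` precedes `u` if
and only if it is `1^i 0 v` with `i < m`, or `i = m` and `v` precedes `w`. In the ensemble of the
bounded halting problem each of the `m` blocks of the first kind has the measure `1 / n`, which
gives `(m + 0.w) / n`, where `0.w` is a binary fraction (`sumBefore_haltingWeight`). If `n = g(l)`
for some `l < n`, then the guarded codes of length `n` are the words `1^m 0 w` with `|w| = l`, all
of the same measure, and the induced distribution function is `0`, `0.w` or `1`, according to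
whether `|w|` is greater than, equal to or less than `l` (`sumBefore_guardedWeight`). For all
other `n` there are no guarded codes of length `n`, and nothing changes. In particular there are
none at all if `g` is the identity, so that the unrestricted problem is a special case
(`restrictedDBH_id`).

*Its computation.* As `n` and all other numbers involved are polynomially bounded, they can be
kept in unary, on stacks, each of which is one side of a tape. A loop with a polynomially bounded
number of rounds, whose stacks stay polynomially bounded, takes polynomial time (`PolyTime.loop`),
and this is how each part of the program is analysed. Although `g` is a polynomial with real
coefficients, Newton's forward difference formula for the values `g(0), g(1), …` shows that a
multiple of `g` has integer coefficients. Hence `g(l) = n` is equivalent to an equation `p(l + 1)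
= q(l + 1) + r n` between polynomials with natural coefficients (`exists_equation`), and the
preimage is found by trying all values. The digits of the quotient then come from long division,
in which the word `w` supplies the digits of the dividend behind the binary point
(`Store.division`).

*The reduction.* The induced ensemble exceeds the original one at most by the factor `n + 1`
(`induced_prob_le`), which a strongly generic bound absorbs. The composition `A ∘ F` outputs on
`x` precisely what `A` outputs on the output of `F`, later by the running time of `F` and the time
needed to copy and rewind (`MTM.comp_outputsIn`). Hence it partially decides the same set, and its
running time exceeds that of `A` by a polynomial only.
-/

noncomputable section

namespace GenericNP

open Turing

/-! ### Computations without choice -/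

namespace MTM

variable {α β : Type} {M : MTM α β}

/-- `Forced c n d`: every computation from `c` passes through `d` after exactly `n` steps, and each
of these steps is the only one possible. -/
inductive Forced (M : MTM α β) : M.Cfg → ℕ → M.Cfg → Prop
  | refl (c : M.Cfg) : Forced M c 0 c
  | step {c e d : M.Cfg} {n : ℕ} (h : M.Step c e) (uniq : ∀ e', M.Step c e' → e' = e)
      (rest : Forced M e n d) : Forced M c (n + 1) d

theorem Forced.trans {c d e : M.Cfg} {m n : ℕ} (h : Forced M c m d) (h' : Forced M d n e) :
    Forced M c (m + n) e := by
  induction h with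
  | refl => simpa using h'
  | step hs hu _ ih =>
    rw [Nat.add_right_comm]
    exact .step hs hu (ih h')

theorem ReachesIn.trans {c d e : M.Cfg} {m n : ℕ} (h : M.ReachesIn m c d)
    (h' : M.ReachesIn n d e) : M.ReachesIn (m + n) c e := by
  induction m generalizing c with
  | zero => cases h; simpa using h'
  | succ m ih =>
    obtain ⟨f, hf, h⟩ := h
    rw [Nat.add_right_comm]
    exact ⟨f, hf, ih h⟩

theorem Forced.reachesIn {c d : M.Cfg} {n : ℕ} (h : Forced M c n d) : M.ReachesIn n c d := by
  induction h with
  | refl => rfl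
  | step hs _ _ ih => exact ⟨_, hs, ih⟩

/-- A computation that starts with a forced stretch either is still inside this stretch, and then it
has not halted, or it has passed through the end of it. -/
theorem Forced.split {c d e : M.Cfg} {t n : ℕ} (h : Forced M c t d) (h' : M.ReachesIn n c e) :
    (n < t ∧ e.state ≠ M.halt) ∨ (t ≤ n ∧ M.ReachesIn (n - t) d e) := by
  induction h generalizing n with
  | refl => exact .inr ⟨Nat.zero_le _, h'⟩
  | step hs hu _ ih =>
    cases n with
    | zero => cases h'; exact .inl ⟨Nat.succ_pos _, hs.1⟩
    | succ n =>
      obtain ⟨f, hf, h'⟩ := h'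
      rw [hu f hf] at h'
      rcases ih h' with ⟨h1, h2⟩ | ⟨h1, h2⟩
      · exact .inl ⟨by omega, h2⟩
      · exact .inr ⟨by omega, by simpa using h2⟩

/-- The configuration after the transition to state `q` that writes `w` and moves as `d` says. -/
def Cfg.next (c : M.Cfg) (q : M.Q) (w : M.ι → Option M.Γ) (d : M.ι → Option Dir) : M.Cfg :=
  ⟨q, fun i => moveTape (d i) ((c.tape i).write (w i))⟩

theorem step_iff {c e : M.Cfg} : M.Step c e ↔ c.state ≠ M.halt ∧ ∃ w d,
    M.δ c.state (fun i => (c.tape i).head) e.state w d ∧ e = c.next e.state w d := by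
  refine and_congr_right fun _ => exists_congr fun w => exists_congr fun d =>
    and_congr_right fun _ => ?_
  cases e
  simp [Cfg.next, funext_iff]

theorem step_next {c : M.Cfg} {q : M.Q} {w : M.ι → Option M.Γ} {d : M.ι → Option Dir}
    (hc : c.state ≠ M.halt) (h : M.δ c.state (fun i => (c.tape i).head) q w d) :
    M.Step c (c.next q w d) :=
  step_iff.2 ⟨hc, w, d, h, rfl⟩

/-- A transition that is the only applicable one forces the computation. -/
theorem Forced.single {c : M.Cfg} {q : M.Q} {w : M.ι → Option M.Γ} {d : M.ι → Option Dir}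
    (hc : c.state ≠ M.halt) (h : M.δ c.state (fun i => (c.tape i).head) q w d)
    (uniq : ∀ q' w' d', M.δ c.state (fun i => (c.tape i).head) q' w' d' →
      q' = q ∧ w' = w ∧ d' = d) :
    Forced M c 1 (c.next q w d) := by
  refine .step (step_next hc h) (fun e' he' => ?_) (.refl _)
  obtain ⟨_, w', d', h', he⟩ := step_iff.1 he'
  obtain ⟨h1, rfl, rfl⟩ := uniq _ _ _ h'
  rw [he, h1]

theorem Deterministic.forced (hM : M.Deterministic) {c d : M.Cfg} {n : ℕ}
    (h : M.ReachesIn n c d) : Forced M c n d := by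
  induction n generalizing c with
  | zero => cases h; exact .refl _
  | succ n ih =>
    obtain ⟨e, he, h⟩ := h
    refine .step he (fun e' he' => ?_) (ih h)
    obtain ⟨_, w, b, h1, h2⟩ := step_iff.1 he
    obtain ⟨_, w', b', h1', h2'⟩ := step_iff.1 he'
    obtain ⟨e1, rfl, rfl⟩ := hM _ _ _ _ _ _ _ _ h1' h1
    rw [h2, h2', e1]

end MTM

/-! ### Tapes -/

section Tapes

variable {Γ : Type}

theorem listBlank_mk_blank : (ListBlank.mk [(none : Option Γ)]) = ListBlank.mk [] :=
  Quotient.sound' (.inr ⟨1, rfl⟩)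

theorem tape_head_right₀ (T : Tape (Option Γ)) : T.right₀.head = T.head := by
  simp [Tape.right₀]

theorem tape_right₀_move_right (T : Tape (Option Γ)) :
    (T.move .right).right₀ = T.right₀.tail := by
  simp [Tape.right₀, Tape.move]

theorem tape_right₀_move_left_write (T : Tape (Option Γ)) (a : Option Γ) :
    ((T.move .left).write a).right₀ = T.right₀.cons a := by
  simp [Tape.right₀, Tape.move, Tape.write]

/-- The tape with the letters of `l` before its head, the nearest first, and those of `r` from its
head on. -/
def wordTape (l r : List Γ) : Tape (Option Γ) := Tape.mk₂ (l.map some) (r.map some)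

theorem wordTape_nil_left (r : List Γ) : wordTape [] r = Tape.mk₁ (r.map some) := rfl

theorem wordTape_nil : wordTape [] ([] : List Γ) = Tape.mk₁ [] := rfl

theorem wordTape_head_nil (l : List Γ) : (wordTape l []).head = none := rfl

theorem wordTape_head_cons (l r : List Γ) (a : Γ) : (wordTape l (a :: r)).head = some a := rfl

theorem wordTape_move_right (l r : List Γ) (a : Γ) :
    (wordTape l (a :: r)).move .right = wordTape (a :: l) r := by
  simp [wordTape, Tape.mk₂]

theorem wordTape_move_left (l r : List Γ) (a : Γ) :
    (wordTape (a :: l) r).move .left = wordTape l (a :: r) := by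
  simp [wordTape, Tape.mk₂]

theorem wordTape_write (l r : List Γ) (a b : Γ) :
    (wordTape l (a :: r)).write (some b) = wordTape l (b :: r) := rfl

theorem wordTape_write_nil (l : List Γ) (b : Γ) :
    (wordTape l []).write (some b) = wordTape l [b] := rfl

theorem wordTape_erase (r : List Γ) (a : Γ) :
    ((wordTape [] (a :: r)).write none).move .right = wordTape [] r := by
  simp only [wordTape, Tape.mk₂, Tape.mk', Tape.write, Tape.move, List.map_nil,
    List.map_cons, ListBlank.head_mk, ListBlank.tail_mk, ListBlank.cons_mk, List.tail_cons,
    listBlank_mk_blank]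

theorem wordTape_blank_head (r : List Γ) : ((wordTape [] r).move .left).head = none := rfl

end Tapes

/-! ### The bounded halting problem is in `NP` -/

section ClockedSimulation

variable (M : NTM Bool)

/-- The states of the clocked simulation of `M`: `erase` removes the block of ones in front of the
first zero, `walk` goes to the end of the input word of `M`, `rewind` goes back to its beginning,
`sim q` simulates `M` in the state `q`, and `accept` is the halting state. -/
inductive ClockState
  | erase
  | walk
  | rewind
  | sim (q : M.Q)
  | accept

instance : Finite (ClockState M) := by
  refine Finite.of_injective (β := Option M.Q × Fin 4) (fun s => match s with
    | .erase => (none, 0)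
    | .walk => (none, 1)
    | .rewind => (none, 2)
    | .sim q => (some q, 0)
    | .accept => (none, 3)) ?_
  intro a b h
  cases a <;> cases b <;> simp_all

/-- The transitions of the clocked simulation of `M`. Tape `0` holds the input and becomes the tape
of `M`, tape `1` is a clock that receives one mark for each letter of the input and loses one with
each simulated step, tape `2` is the output tape. -/
inductive ClockStep : ClockState M → (Fin 3 → Option Bool) → ClockState M →
    (Fin 3 → Option Bool) → (Fin 3 → Option Dir) → Prop
  | erase (r : Fin 3 → Option Bool) (h : r 0 = some true) :
      ClockStep .erase r .erase ![none, some true, r 2] ![some .right, some .left, none]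
  | sep (r : Fin 3 → Option Bool) (h : r 0 = some false) :
      ClockStep .erase r .walk ![none, some true, some true] ![some .right, some .left, some .left]
  | walk (r : Fin 3 → Option Bool) (b : Bool) (h : r 0 = some b) :
      ClockStep .walk r .walk ![some b, some true, r 2] ![some .right, some .left, none]
  | turn (r : Fin 3 → Option Bool) (h : r 0 = none) :
      ClockStep .walk r .rewind r ![some .left, some .right, none]
  | back (r : Fin 3 → Option Bool) (h : r 0 ≠ none) :
      ClockStep .rewind r .rewind r ![some .left, none, none]
  | launch (r : Fin 3 → Option Bool) (h : r 0 = none) :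
      ClockStep .rewind r (.sim M.start) r ![some .right, none, none]
  | sim (r : Fin 3 → Option Bool) {q q' : M.Q} {a : Bool} {d : Dir} (hr : r 1 = some true)
      (h : M.δ q (r 0) q' a d) :
      ClockStep (.sim q) r (.sim q') ![some a, r 1, r 2] ![some d, some .right, none]
  | accept (r : Fin 3 → Option Bool) :
      ClockStep (.sim M.halt) r .accept ![r 0, r 1, some true] ![none, none, none]

/-- The clocked simulation of `M`, a nondeterministic machine for the bounded halting problem. -/
abbrev clocked : MTM Bool Bool where
  ι := Fin 3
  inTape := 0
  outTape := 2
  Γ := Bool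
  inp := .refl _
  out := .refl _
  Q := ClockState M
  start := .erase
  halt := .accept
  δ := ClockStep M

/-- A configuration of the clocked simulation. -/
def clockCfg (s : ClockState M) (T C O : Tape (Option Bool)) : (clocked M).Cfg := ⟨s, ![T, C, O]⟩

/-- The clock tape with `j` marks while it is being wound up: the head is on the blank in front of
the marks. -/
def windingTape (j : ℕ) : Tape (Option Bool) :=
  Tape.mk₁ (none :: List.replicate j (some true))

theorem windingTape_succ (j : ℕ) :
    ((windingTape j).write (some true)).move .left = windingTape (j + 1) := rfl

theorem windingTape_zero : windingTape 0 = Tape.mk₁ [] := by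
  simp only [windingTape, Tape.mk₁, Tape.mk₂, List.replicate_zero, listBlank_mk_blank]

variable {M}

theorem clocked_next (c : (clocked M).Cfg) (s : ClockState M) (w : Fin 3 → Option Bool)
    (d : Fin 3 → Option Dir) : c.next s w d = clockCfg M s
      (moveTape (d 0) ((c.tape 0).write (w 0))) (moveTape (d 1) ((c.tape 1).write (w 1)))
      (moveTape (d 2) ((c.tape 2).write (w 2))) := by
  simp only [MTM.Cfg.next, clockCfg, MTM.Cfg.mk.injEq, true_and]
  funext i
  fin_cases i <;> rfl

theorem clocked_init (u : List Bool) :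
    (clocked M).init u = clockCfg M .erase (wordTape [] u) (windingTape 0) (Tape.mk₁ []) := by
  simp only [MTM.init, clockCfg, MTM.Cfg.mk.injEq, true_and, windingTape_zero]
  funext i
  fin_cases i <;> rfl

theorem forced_erase (m j : ℕ) (u : List Bool) (O : Tape (Option Bool)) :
    MTM.Forced (clocked M)
      (clockCfg M .erase (wordTape [] (List.replicate m true ++ u)) (windingTape j) O) m
      (clockCfg M .erase (wordTape [] u) (windingTape (j + m)) O) := by
  induction m generalizing j with
  | zero => exact .refl _
  | succ m ih =>
    rw [Nat.add_comm m 1]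
    refine .trans (.single (q := ClockState.erase) (by simp [clockCfg])
      (.erase _ (by rw [Nat.add_comm]; rfl)) ?_) ?_
    · rintro q w d h
      cases h with
      | erase => simp
      | sep _ h => simp [clockCfg, Nat.add_comm 1 m, List.replicate_succ, wordTape_head_cons] at h
    · have := ih (j + 1)
      rw [clocked_next]
      simpa [clockCfg, moveTape, List.replicate_succ, wordTape_erase, windingTape_succ,
        Nat.add_comm 1 m, Nat.add_right_comm j 1 m, Nat.add_assoc] using this

theorem forced_sep (j : ℕ) (w : List Bool) :
    MTM.Forced (clocked M)
      (clockCfg M .erase (wordTape [] (false :: w)) (windingTape j) (Tape.mk₁ [])) 1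
      (clockCfg M .walk (wordTape [] w) (windingTape (j + 1)) (windingTape 1)) := by
  have := MTM.Forced.single (M := clocked M)
    (c := clockCfg M .erase (wordTape [] (false :: w)) (windingTape j) (Tape.mk₁ []))
    (q := ClockState.walk) (by simp [clockCfg]) (.sep _ rfl) (by
      rintro q w d h
      cases h with
      | sep => simp
      | erase _ h => simp [clockCfg, wordTape_head_cons] at h)
  rw [clocked_next] at this
  simpa [clockCfg, moveTape, wordTape_erase, windingTape_succ, ← windingTape_zero] using this

theorem forced_walk (j : ℕ) (v w : List Bool) (O : Tape (Option Bool)) :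
    MTM.Forced (clocked M) (clockCfg M .walk (wordTape v w) (windingTape j) O) w.length
      (clockCfg M .walk (wordTape (w.reverse ++ v) []) (windingTape (j + w.length)) O) := by
  induction w generalizing v j with
  | nil => exact .refl _
  | cons b w ih =>
    rw [List.length_cons, Nat.add_comm w.length 1]
    refine .trans (.single (q := ClockState.walk) (by simp [clockCfg]) (.walk _ b rfl) ?_) ?_
    · rintro q w d h
      cases h with
      | walk _ b' h =>
        simp only [clockCfg, Matrix.cons_val_zero, wordTape_head_cons, Option.some.injEq] at h
        simp [h]
      | turn _ h => simp [clockCfg, wordTape_head_cons] at h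
    · have := ih (j + 1) (b :: v)
      rw [clocked_next]
      simpa [clockCfg, moveTape, wordTape_write, wordTape_move_right, windingTape_succ,
        Nat.add_comm 1, Nat.add_right_comm j 1, Nat.add_assoc] using this

theorem forced_turn (v : List Bool) (C O : Tape (Option Bool)) :
    MTM.Forced (clocked M) (clockCfg M .walk (wordTape v []) C O) 1
      (clockCfg M .rewind ((wordTape v []).move .left) (C.move .right) O) := by
  have := MTM.Forced.single (M := clocked M) (c := clockCfg M .walk (wordTape v []) C O)
    (q := ClockState.rewind) (by simp [clockCfg]) (.turn _ rfl) (by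
      rintro q w d h
      cases h with
      | turn => simp
      | walk _ b h => simp [clockCfg, wordTape_head_nil] at h)
  rw [clocked_next] at this
  simpa [clockCfg, moveTape] using this

theorem forced_rewind (v w : List Bool) (C O : Tape (Option Bool)) :
    MTM.Forced (clocked M) (clockCfg M .rewind ((wordTape v w).move .left) C O) (v.length + 1)
      (clockCfg M (.sim M.start) (wordTape [] (v.reverse ++ w)) C O) := by
  induction v generalizing w with
  | nil =>
    have := MTM.Forced.single (M := clocked M)
      (c := clockCfg M .rewind ((wordTape [] w).move .left) C O)
      (q := ClockState.sim M.start) (by simp [clockCfg]) (.launch _ rfl) (by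
        rintro q w d h
        cases h with
        | launch => simp
        | back _ h => simp [clockCfg, wordTape_blank_head] at h)
    rw [clocked_next] at this
    simpa [clockCfg, moveTape] using this
  | cons b v ih =>
    rw [List.length_cons, Nat.add_comm (v.length + 1) 1]
    refine .trans (.single (q := ClockState.rewind) (by simp [clockCfg])
      (.back _ (by simp [clockCfg, wordTape_move_left, wordTape_head_cons])) ?_) ?_
    · rintro q w d h
      cases h with
      | back => simp
      | launch _ h => simp [clockCfg, wordTape_move_left, wordTape_head_cons] at h
    · have := ih (b :: w)
      rw [clocked_next]
      simpa [clockCfg, moveTape, wordTape_move_left] using this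

/-- On the word `1^m 0 w`, the simulation of `M` on `w` starts with a clock that has one mark for
each letter of `1^m 0 w`. -/
theorem forced_launch (m : ℕ) (w : List Bool) :
    ∃ C : Tape (Option Bool),
      C.right₀ = ListBlank.mk (List.replicate (code m w).length (some true)) ∧
      MTM.Forced (clocked M) ((clocked M).init (code m w)) (m + 2 * w.length + 3)
        (clockCfg M (.sim M.start) (wordTape [] w) C (windingTape 1)) := by
  refine ⟨(windingTape (m + 1 + w.length)).move .right, ?_, ?_⟩
  · simp only [tape_right₀_move_right, windingTape, Tape.mk₁, Tape.mk₂, Tape.mk'_right₀,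
      ListBlank.tail_mk, List.tail_cons, code, List.length_append, List.length_replicate,
      List.length_cons]
    congr 2
    omega
  · rw [clocked_init, code]
    have h1 := forced_erase (M := M) m 0 (false :: w) (Tape.mk₁ [])
    have h2 := forced_sep (M := M) (0 + m) w
    have h3 := forced_walk (M := M) (0 + m + 1) [] w (windingTape 1)
    have h4 := forced_turn (M := M) (w.reverse ++ []) (windingTape (0 + m + 1 + w.length))
      (windingTape 1)
    have h5 := forced_rewind (M := M) (w.reverse ++ []) []
      ((windingTape (0 + m + 1 + w.length)).move .right) (windingTape 1)
    have h := (((h1.trans h2).trans h3).trans h4).trans h5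
    have e : m + 1 + w.length + 1 + ((w.reverse ++ []).length + 1) = m + 2 * w.length + 3 := by
      simp; omega
    rw [e] at h
    simpa using h

/-- Soundness of the simulation, with the bound on its length: with `j` marks on the clock it ends
within `j + 1` steps, and it accepts only if `M` can halt within `j` steps. -/
theorem clocked_sound {n j : ℕ} {q : M.Q} {T C O : Tape (Option Bool)} {e : (clocked M).Cfg}
    (hC : C.right₀ = ListBlank.mk (List.replicate j (some true)))
    (h : (clocked M).ReachesIn n (clockCfg M (.sim q) T C O) e) :
    n ≤ j + 1 ∧ (e.state = ClockState.accept →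
      ∃ m ≤ j, ∃ T', M.ReachesIn m (q, T) (M.halt, T')) := by
  induction n generalizing j q T C with
  | zero =>
    cases h
    exact ⟨Nat.zero_le _, fun h => by cases h⟩
  | succ n ih =>
    obtain ⟨f, hf, h⟩ := h
    obtain ⟨_, w, d, hd, hf⟩ := MTM.step_iff.1 hf
    rw [hf] at h
    clear hf
    generalize f.state = s at hd h
    rw [clocked_next] at h
    simp only [clockCfg] at hd h
    cases hd with
    | @sim _ _ q' a d hr hδ =>
      replace hr : C.head = some true := hr
      cases j with
      | zero =>
        rw [← tape_head_right₀, hC] at hr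
        simp at hr
      | succ j =>
        have hC' : (((C.write C.head).move .right).right₀) =
            ListBlank.mk (List.replicate j (some true)) := by
          rw [Tape.write_self, tape_right₀_move_right, hC]
          rfl
        obtain ⟨h1, h2⟩ := ih hC' h
        refine ⟨by omega, fun he => ?_⟩
        obtain ⟨m, hm, T', h'⟩ := h2 he
        exact ⟨m + 1, by omega, T', (q', (T.write (some a)).move d), ⟨a, d, hδ, rfl⟩, h'⟩
    | accept =>
      cases n with
      | zero => exact ⟨by omega, fun _ => ⟨0, Nat.zero_le _, T, rfl⟩⟩
      | succ n =>
        obtain ⟨f, hf, _⟩ := h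
        exact absurd rfl hf.1

/-- Completeness of the simulation: a computation of `M` that halts before the clock runs out is
followed by acceptance. -/
theorem clocked_complete {m j : ℕ} {q : M.Q} {T T' C O : Tape (Option Bool)} (hm : m ≤ j)
    (hC : C.right₀ = ListBlank.mk (List.replicate j (some true)))
    (h : M.ReachesIn m (q, T) (M.halt, T')) :
    ∃ (n : ℕ) (C' : Tape (Option Bool)), (clocked M).ReachesIn n (clockCfg M (.sim q) T C O)
      (clockCfg M .accept T' C' (O.write (some true))) := by
  induction m generalizing j q T C with
  | zero =>
    cases h
    refine ⟨1, C, _, MTM.step_next (q := ClockState.accept) (by simp [clockCfg]) (.accept _), ?_⟩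
    rw [clocked_next]
    simp [clockCfg, moveTape, MTM.ReachesIn]
  | succ m ih =>
    obtain ⟨⟨q', S⟩, ⟨a, d, hδ, hS⟩, h⟩ := h
    obtain ⟨j, rfl⟩ : ∃ i, j = i + 1 := ⟨j - 1, by omega⟩
    have hC' : (C.move .right).right₀ = ListBlank.mk (List.replicate j (some true)) := by
      rw [tape_right₀_move_right, hC]
      rfl
    obtain ⟨n, C', h'⟩ := ih (by omega) hC' h
    have hr : C.head = some true := by
      rw [← tape_head_right₀, hC]
      rfl
    have hδ' : ClockStep M (.sim q) (fun i => (![T, C, O] i).head) (.sim q') _ _ := .sim _ hr hδ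
    refine ⟨n + 1, C', _, MTM.step_next (by simp [clockCfg]) hδ', ?_⟩
    rw [clocked_next]
    simp only at hS
    rw [hS] at h'
    simpa [clockCfg, moveTape] using h'

theorem code_or_replicate (u : List Bool) :
    (∃ m w, u = code m w) ∨ ∃ m, u = List.replicate m true := by
  induction u with
  | nil => exact .inr ⟨0, rfl⟩
  | cons b u ih =>
    cases b with
    | false => exact .inl ⟨0, u, rfl⟩
    | true =>
      rcases ih with ⟨m, w, rfl⟩ | ⟨m, rfl⟩
      · exact .inl ⟨m + 1, w, by simp [code, List.replicate_succ]⟩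
      · exact .inr ⟨m + 1, by simp [List.replicate_succ]⟩

theorem dropWhile_code (m : ℕ) (w : List Bool) : (code m w).dropWhile id = false :: w := by
  unfold code
  induction m with
  | zero => rfl
  | succ m ih => simp [List.replicate_succ]

theorem dropWhile_replicate (m : ℕ) : (List.replicate m true).dropWhile id = [] := by
  induction m <;> simp

theorem length_code (m : ℕ) (w : List Bool) : (code m w).length = m + 1 + w.length := by
  simp [code]
  omega

theorem code_inj {m m' : ℕ} {w w' : List Bool} (h : code m w = code m' w') : m = m' ∧ w = w' := by
  have hw : w = w' := by
    have := congrArg (List.dropWhile id) h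
    simpa [dropWhile_code] using this
  subst hw
  have := congrArg List.length h
  rw [length_code, length_code] at this
  exact ⟨by omega, rfl⟩

theorem replicate_ne_code (k m : ℕ) (w : List Bool) : List.replicate k true ≠ code m w := by
  intro h
  have := congrArg (List.dropWhile id) h
  simp [dropWhile_code] at this

theorem code_mem_boundedHalting {m : ℕ} {w : List Bool} :
    code m w ∈ boundedHalting M ↔ M.HaltsWithin w (code m w).length := by
  refine ⟨?_, fun h => ⟨m, w, rfl, h⟩⟩
  rintro ⟨m', w', h, hM⟩
  obtain ⟨rfl, rfl⟩ := code_inj h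
  exact hM

variable (M) in
theorem boundedHalting_inNP : InNP (boundedHalting M) := by
  refine ⟨clocked M, 3 * Polynomial.X + 4, fun u => ?_⟩
  rcases code_or_replicate u with ⟨m, w, rfl⟩ | ⟨m, rfl⟩
  · obtain ⟨C, hC, hF⟩ := forced_launch (M := M) m w
    rw [code_mem_boundedHalting]
    refine ⟨⟨?_, ?_⟩, ?_⟩
    · rintro ⟨t, ht, T, hT⟩
      obtain ⟨n, C', hn⟩ := clocked_complete (O := windingTape 1) ht hC hT
      refine ⟨_, [], _, hF.reachesIn.trans hn, rfl, ?_⟩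
      simp [clockCfg, windingTape, Tape.mk₁, Tape.mk₂, Tape.write, Tape.mk', Tape.right₀]
    · rintro ⟨n, y, e, he, hs, -⟩
      rcases hF.split he with ⟨-, h⟩ | ⟨-, h⟩
      · exact absurd hs h
      · exact (clocked_sound hC h).2 hs
    · intro n e he
      simp only [Polynomial.eval_add, Polynomial.eval_mul, Polynomial.eval_ofNat, Polynomial.eval_X]
      rcases hF.split he with ⟨h, -⟩ | ⟨-, h⟩
      · rw [length_code]
        omega
      · have := (clocked_sound hC h).1
        rw [length_code] at *
        omega
  · -- On a block of ones the machine gets stuck at the blank behind it.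
    have hF := forced_erase (M := M) m 0 [] (Tape.mk₁ [])
    rw [List.append_nil, ← clocked_init] at hF
    have stuck : ∀ n e, (clocked M).ReachesIn n ((clocked M).init (List.replicate m true)) e →
        n ≤ m ∧ e.state ≠ ClockState.accept := by
      intro n e he
      rcases hF.split he with ⟨h1, h2⟩ | ⟨h1, h2⟩
      · exact ⟨h1.le, h2⟩
      · obtain ⟨k, hk⟩ : ∃ k, n - m = k := ⟨_, rfl⟩
        rw [hk] at h2
        cases k with
        | zero =>
          cases h2
          exact ⟨by omega, fun h => by cases h⟩
        | succ k =>
          obtain ⟨f, hf, -⟩ := h2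
          obtain ⟨-, w, d, hd, -⟩ := MTM.step_iff.1 hf
          exfalso
          generalize f.state = s at hd
          simp only [clockCfg] at hd
          cases hd with
          | erase _ h => simp [wordTape_head_nil] at h
          | sep _ h => simp [wordTape_head_nil] at h
    refine ⟨⟨?_, ?_⟩, ?_⟩
    · rintro ⟨m', w, h, -⟩
      exact absurd h (replicate_ne_code _ _ _)
    · rintro ⟨n, y, e, he, hs, -⟩
      exact absurd hs (stuck n e he).2
    · intro n e he
      have := (stuck n e he).1
      simp only [Polynomial.eval_add, Polynomial.eval_mul, Polynomial.eval_ofNat, Polynomial.eval_X,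
        List.length_replicate]
      omega

end ClockedSimulation

/-! ### Deterministic programs on stacks -/

/-- A deterministic program for a machine with tapes `κ` and tape alphabet `Γ`, to be used as a
building block: `δ q r` consists of the next state (`none` means that control leaves the program),
the symbols that are written and the moves of the heads. -/
structure Prog (κ Γ : Type) where
  Q : Type
  [finQ : Finite Q]
  start : Q
  δ : Q → (κ → Option Γ) → Option Q × (κ → Option Γ) × (κ → Option Dir)

attribute [instance] Prog.finQ

namespace Prog

variable {κ Γ : Type}

/-- The tapes after writing `a.1` and moving as `a.2` says. -/
def act (a : (κ → Option Γ) × (κ → Option Dir)) (T : κ → Tape (Option Γ)) : κ → Tape (Option Γ) :=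
  fun i => moveTape (a.2 i) ((T i).write (a.1 i))

/-- The symbols read by the heads. -/
def heads (T : κ → Tape (Option Γ)) : κ → Option Γ := fun i => (T i).head

theorem act_heads (T : κ → Tape (Option Γ)) : act (heads T, fun _ => none) T = T := by
  funext i
  simp [act, heads, moveTape]

/-- `A.Runs q T n T'`: from the state `q` and the tapes `T`, control leaves `A` with the `n`-th
step, with tapes `T'`. -/
inductive Runs (A : Prog κ Γ) : A.Q → (κ → Tape (Option Γ)) → ℕ → (κ → Tape (Option Γ)) → Prop
  | exit {q T} (h : (A.δ q (heads T)).1 = none) : Runs A q T 1 (act (A.δ q (heads T)).2 T)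
  | step {q T q' n T'} (h : (A.δ q (heads T)).1 = some q')
      (rest : Runs A q' (act (A.δ q (heads T)).2 T) n T') : Runs A q T (n + 1) T'

/-- Do nothing. -/
def skip : Prog κ Γ where
  Q := Unit
  start := ()
  δ _ r := (none, r, fun _ => none)

/-- Run `A`, then `B`. -/
def seq (A B : Prog κ Γ) : Prog κ Γ where
  Q := A.Q ⊕ B.Q
  start := .inl A.start
  δ q r := match q with
    | .inl q => (some ((A.δ q r).1.elim (.inr B.start) .inl), (A.δ q r).2)
    | .inr q => ((B.δ q r).1.map .inr, (B.δ q r).2)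

open Classical in
/-- Run `A` if the heads read symbols that satisfy `test`, otherwise run `B`. -/
def ite (test : (κ → Option Γ) → Prop) (A B : Prog κ Γ) : Prog κ Γ where
  Q := Option (A.Q ⊕ B.Q)
  start := none
  δ q r := match q with
    | none => (some (some (if test r then .inl A.start else .inr B.start)), r, fun _ => none)
    | some (.inl q) => ((A.δ q r).1.map fun q => some (.inl q), (A.δ q r).2)
    | some (.inr q) => ((B.δ q r).1.map fun q => some (.inr q), (B.δ q r).2)

open Classical in
/-- Run `A` repeatedly, as long as the heads read symbols that satisfy `test`. -/
def loop (test : (κ → Option Γ) → Prop) (A : Prog κ Γ) : Prog κ Γ where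
  Q := Option A.Q
  start := none
  δ q r := match q with
    | none => (if test r then some (some A.start) else none, r, fun _ => none)
    | some q => (some (A.δ q r).1, (A.δ q r).2)

theorem skip_runs (T : κ → Tape (Option Γ)) : skip.Runs () T 1 T := by
  have h := Runs.exit (A := skip) (q := ()) (T := T) rfl
  rwa [show (skip.δ () (heads T)).2 = (heads T, fun _ => none) from rfl, act_heads] at h

theorem Runs.inr {A B : Prog κ Γ} {q : B.Q} {T T' : κ → Tape (Option Γ)} {n : ℕ}
    (h : B.Runs q T n T') : (A.seq B).Runs (.inr q) T n T' := by
  induction h with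
  | @exit q T h => exact .exit (A := A.seq B) (q := .inr q) (by simp [seq, h])
  | @step q T q' n T' h _ ih => exact .step (A := A.seq B) (q := .inr q) (by simp [seq, h]) ih

theorem Runs.seq {A B : Prog κ Γ} {q : A.Q} {T T' T'' : κ → Tape (Option Γ)} {m n : ℕ}
    (h : A.Runs q T m T') (h' : B.Runs B.start T' n T'') :
    (A.seq B).Runs (.inl q) T (m + n) T'' := by
  induction h with
  | @exit q T h =>
    rw [Nat.add_comm]
    exact .step (A := A.seq B) (q := .inl q) (by simp [Prog.seq, h]) h'.inr
  | @step q T q' n T' h _ ih =>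
    rw [Nat.add_right_comm]
    exact .step (A := A.seq B) (q := .inl q) (by simp [Prog.seq, h]) (ih h')

theorem Runs.ite_inl {test : (κ → Option Γ) → Prop} {A B : Prog κ Γ} {q : A.Q}
    {T T' : κ → Tape (Option Γ)} {n : ℕ} (h : A.Runs q T n T') :
    (ite test A B).Runs (some (.inl q)) T n T' := by
  induction h with
  | @exit q T h => exact .exit (A := ite test A B) (q := some (.inl q)) (by simp [ite, h])
  | @step q T q' n T' h _ ih =>
    exact .step (A := ite test A B) (q := some (.inl q)) (by simp [ite, h]) ih

theorem Runs.ite_inr {test : (κ → Option Γ) → Prop} {A B : Prog κ Γ} {q : B.Q}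
    {T T' : κ → Tape (Option Γ)} {n : ℕ} (h : B.Runs q T n T') :
    (ite test A B).Runs (some (.inr q)) T n T' := by
  induction h with
  | @exit q T h => exact .exit (A := ite test A B) (q := some (.inr q)) (by simp [ite, h])
  | @step q T q' n T' h _ ih =>
    exact .step (A := ite test A B) (q := some (.inr q)) (by simp [ite, h]) ih

theorem Runs.ite_pos {test : (κ → Option Γ) → Prop} {A B : Prog κ Γ}
    {T T' : κ → Tape (Option Γ)} {n : ℕ} (hT : test (heads T)) (h : A.Runs A.start T n T') :
    (ite test A B).Runs none T (n + 1) T' := by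
  refine .step (A := ite test A B) (q := none) (q' := some (.inl A.start)) (by simp [ite, hT]) ?_
  rw [show ((ite test A B).δ none (heads T)).2 = (heads T, fun _ => none) from rfl, act_heads]
  exact h.ite_inl

theorem Runs.ite_neg {test : (κ → Option Γ) → Prop} {A B : Prog κ Γ}
    {T T' : κ → Tape (Option Γ)} {n : ℕ} (hT : ¬test (heads T)) (h : B.Runs B.start T n T') :
    (ite test A B).Runs none T (n + 1) T' := by
  refine .step (A := ite test A B) (q := none) (q' := some (.inr B.start)) (by simp [ite, hT]) ?_
  rw [show ((ite test A B).δ none (heads T)).2 = (heads T, fun _ => none) from rfl, act_heads]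
  exact h.ite_inr

theorem Runs.loop_body {test : (κ → Option Γ) → Prop} {A : Prog κ Γ} {q : A.Q}
    {T T' T'' : κ → Tape (Option Γ)} {m n : ℕ} (h : A.Runs q T m T')
    (h' : (loop test A).Runs none T' n T'') : (loop test A).Runs (some q) T (m + n) T'' := by
  induction h with
  | @exit q T h =>
    rw [Nat.add_comm]
    exact .step (A := loop test A) (q := some q) (by simp [loop, h]) h'
  | @step q T q' n T' h _ ih =>
    rw [Nat.add_right_comm]
    exact .step (A := loop test A) (q := some q) (by simp [loop, h]) (ih h')

theorem Runs.loop_exit {test : (κ → Option Γ) → Prop} {A : Prog κ Γ} {T : κ → Tape (Option Γ)}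
    (hT : ¬test (heads T)) : (loop test A).Runs none T 1 T := by
  have h := Runs.exit (A := loop test A) (q := none) (T := T) (by simp [loop, hT])
  rwa [show ((loop test A).δ none (heads T)).2 = (heads T, fun _ => none) from rfl, act_heads] at h

theorem Runs.loop_step {test : (κ → Option Γ) → Prop} {A : Prog κ Γ}
    {T T' T'' : κ → Tape (Option Γ)} {m n : ℕ} (hT : test (heads T)) (h : A.Runs A.start T m T')
    (h' : (loop test A).Runs none T' n T'') : (loop test A).Runs none T (m + n + 1) T'' := by
  refine .step (A := loop test A) (q := none) (q' := some A.start) (by simp [loop, hT]) ?_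
  rw [show ((loop test A).δ none (heads T)).2 = (heads T, fun _ => none) from rfl, act_heads]
  exact h.loop_body h'

/-- The tape `T i` represents the stack `S i`: it carries `S i`, followed by blanks only, from the
position of its head to the right. -/
def Rep (T : κ → Tape (Option Γ)) (S : κ → List Γ) : Prop :=
  ∀ i, (T i).right₀ = ListBlank.mk ((S i).map some)

theorem Rep.heads_eq {T : κ → Tape (Option Γ)} {S : κ → List Γ} (h : Rep T S) :
    heads T = fun i => (S i).head? := by
  funext i
  rw [heads, ← tape_head_right₀, h i]
  cases S i <;> rfl

/-- `A` transforms the stacks `S` into the stacks `S'` in `n` steps. -/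
def Does (A : Prog κ Γ) (S : κ → List Γ) (n : ℕ) (S' : κ → List Γ) : Prop :=
  ∀ T, Rep T S → ∃ T', A.Runs A.start T n T' ∧ Rep T' S'

theorem skip_does (S : κ → List Γ) : skip.Does S 1 S := fun T h => ⟨T, skip_runs T, h⟩

theorem Does.seq {A B : Prog κ Γ} {S S' S'' : κ → List Γ} {m n : ℕ} (h : A.Does S m S')
    (h' : B.Does S' n S'') : (A.seq B).Does S (m + n) S'' := by
  intro T hT
  obtain ⟨T', hA, hT'⟩ := h T hT
  obtain ⟨T'', hB, hT''⟩ := h' T' hT'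
  exact ⟨T'', hA.seq hB, hT''⟩

theorem Does.ite_pos {test : (κ → Option Γ) → Prop} {A B : Prog κ Γ} {S S' : κ → List Γ} {n : ℕ}
    (hS : test fun i => (S i).head?) (h : A.Does S n S') : (ite test A B).Does S (n + 1) S' := by
  intro T hT
  obtain ⟨T', hA, hT'⟩ := h T hT
  exact ⟨T', hA.ite_pos (by rwa [hT.heads_eq]), hT'⟩

theorem Does.ite_neg {test : (κ → Option Γ) → Prop} {A B : Prog κ Γ} {S S' : κ → List Γ} {n : ℕ}
    (hS : ¬test fun i => (S i).head?) (h : B.Does S n S') : (ite test A B).Does S (n + 1) S' := by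
  intro T hT
  obtain ⟨T', hA, hT'⟩ := h T hT
  exact ⟨T', hA.ite_neg (by rwa [hT.heads_eq]), hT'⟩

theorem Does.loop_exit {test : (κ → Option Γ) → Prop} {A : Prog κ Γ} {S : κ → List Γ}
    (hS : ¬test fun i => (S i).head?) : (loop test A).Does S 1 S := fun T hT =>
  ⟨T, .loop_exit (by rwa [hT.heads_eq]), hT⟩

theorem Does.loop_step {test : (κ → Option Γ) → Prop} {A : Prog κ Γ} {S S' S'' : κ → List Γ}
    {m n : ℕ} (hS : test fun i => (S i).head?) (h : A.Does S m S')
    (h' : (loop test A).Does S' n S'') : (loop test A).Does S (m + n + 1) S'' := by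
  intro T hT
  obtain ⟨T', hA, hT'⟩ := h T hT
  obtain ⟨T'', hB, hT''⟩ := h' T' hT'
  exact ⟨T'', hA.loop_step (by rwa [hT.heads_eq]) hB, hT''⟩

/-- What to do with one of the stacks. -/
inductive Edit (Γ : Type)
  | keep
  | pop
  | push (a : Γ)

/-- The effect of an edit on a stack. -/
def Edit.apply : Edit Γ → List Γ → List Γ
  | keep, l => l
  | pop, l => l.tail
  | push a, l => a :: l

/-- Edit all stacks: first move the heads, then write the symbols that are pushed. -/
def edit (e : κ → Edit Γ) : Prog κ Γ where
  Q := Bool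
  start := false
  δ q r := match q with
    | false => (some true, r, fun i => match e i with
      | .keep => none
      | .pop => some .right
      | .push _ => some .left)
    | true => (none, fun i => match e i with
      | .push a => some a
      | _ => r i, fun _ => none)

theorem edit_does (e : κ → Edit Γ) (S : κ → List Γ) :
    (edit e).Does S 2 fun i => (e i).apply (S i) := by
  intro T hT
  refine ⟨_, .step (A := edit e) (q := false) rfl (.exit (A := edit e) (q := true) rfl),
    fun i => ?_⟩
  have := hT i
  simp only [act, edit, heads]
  cases e i with
  | keep => simpa [moveTape, Edit.apply] using this
  | pop => simp [moveTape, Edit.apply, tape_right₀_move_right, this]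
  | push a => simp [moveTape, Edit.apply, tape_right₀_move_left_write, this]

/-- The Turing machine that runs `A` and halts. -/
abbrev toMTM {α β : Type} [Finite κ] [Finite Γ] (A : Prog κ Γ) (i j : κ) (inp : α ↪ Γ)
    (out : β ↪ Γ) : MTM α β where
  ι := κ
  inTape := i
  outTape := j
  Γ := Γ
  inp := inp
  out := out
  Q := Option A.Q
  start := some A.start
  halt := none
  δ q r q' w d := ∃ p, q = some p ∧ A.δ p r = (q', w, d)

section toMTM

variable {α β : Type} [Finite κ] [Finite Γ] {A : Prog κ Γ} {i j : κ} {inp : α ↪ Γ} {out : β ↪ Γ}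

theorem toMTM_deterministic : (A.toMTM i j inp out).Deterministic := by
  rintro q r q₁ w₁ d₁ q₂ w₂ d₂ ⟨p, rfl, h⟩ ⟨p', hp, h'⟩
  cases hp
  rw [h] at h'
  simpa using h'

theorem Runs.reachesIn {q : A.Q} {T T' : κ → Tape (Option Γ)} {n : ℕ} (h : A.Runs q T n T') :
    (A.toMTM i j inp out).ReachesIn n ⟨some q, T⟩ ⟨none, T'⟩ := by
  induction h with
  | @exit q T h =>
    exact ⟨⟨none, act (A.δ q (heads T)).2 T⟩,
      ⟨by simp, _, _, ⟨q, rfl, Prod.ext h rfl⟩, fun _ => rfl⟩, rfl⟩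
  | @step q T q' n T' h _ ih =>
    exact ⟨⟨some q', act (A.δ q (heads T)).2 T⟩,
      ⟨by simp, _, _, ⟨q, rfl, Prod.ext h rfl⟩, fun _ => rfl⟩, ih⟩

open Classical in
theorem Does.outputsIn {x : List α} {n : ℕ} {S : κ → List Γ} {y : List β}
    (h : A.Does (fun k => if k = i then x.map inp else []) n S) (hy : S j = y.map out) :
    (A.toMTM i j inp out).OutputsIn x n y := by
  obtain ⟨T, hT, hS⟩ := h ((A.toMTM i j inp out).init x).tape (fun k => by
    simp only [MTM.init, Tape.mk₁, Tape.mk₂, Tape.mk'_right₀]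
    split_ifs <;> simp [Function.comp_def])
  refine ⟨_, hT.reachesIn, rfl, ?_⟩
  rw [hS j, hy, List.map_map]
  rfl

end toMTM

end Prog

/-! ### Polynomial time transformations -/

theorem polynomial_eval_mono (p : Polynomial ℕ) {a b : ℕ} (h : a ≤ b) : p.eval a ≤ p.eval b := by
  rw [Polynomial.eval_eq_sum_range, Polynomial.eval_eq_sum_range]
  gcongr

section PolyTime

variable {κ Γ σ : Type} [Fintype κ] (enc : σ → κ → List Γ)

/-- The total height of the stacks that encode `s`. -/
def size (s : σ) : ℕ := ∑ i, (enc s i).length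

theorem length_le_size (s : σ) (i : κ) : (enc s i).length ≤ size enc s :=
  Finset.single_le_sum (f := fun i => (enc s i).length) (fun _ _ => Nat.zero_le _)
    (Finset.mem_univ i)

/-- Some program transforms, in polynomial time and with a result of polynomial size, the stacks
that encode a state `s` with `P s` into the stacks that encode a state `s'` with `R s s'`. -/
def PolyTime (P : σ → Prop) (R : σ → σ → Prop) : Prop :=
  ∃ (A : Prog κ Γ) (p : Polynomial ℕ), ∀ s, P s → ∃ s', R s s' ∧ size enc s' ≤ p.eval (size enc s) ∧
    ∃ n ≤ p.eval (size enc s), A.Does (enc s) n (enc s')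

variable {enc} {P P' Q : σ → Prop} {R R' : σ → σ → Prop}

theorem PolyTime.mono (h : PolyTime enc P R) (hP : ∀ s, P' s → P s)
    (hR : ∀ s s', P' s → R s s' → R' s s') : PolyTime enc P' R' := by
  obtain ⟨A, p, h⟩ := h
  refine ⟨A, p, fun s hs => ?_⟩
  obtain ⟨s', h1, h2⟩ := h s (hP s hs)
  exact ⟨s', hR s s' hs h1, h2⟩

theorem PolyTime.skip : PolyTime enc P fun s s' => s' = s :=
  ⟨.skip, Polynomial.X + 1, fun s _ => ⟨s, rfl, by simp, 1, by simp, Prog.skip_does _⟩⟩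

theorem PolyTime.seq (h : PolyTime enc P R) (h' : PolyTime enc Q R')
    (hQ : ∀ s t, P s → R s t → Q t) : PolyTime enc P fun s u => ∃ t, R s t ∧ R' t u := by
  obtain ⟨A, p, h⟩ := h
  obtain ⟨B, q, h'⟩ := h'
  refine ⟨A.seq B, p + q.comp p, fun s hs => ?_⟩
  obtain ⟨t, hst, ht, m, hm, hA⟩ := h s hs
  obtain ⟨u, htu, hu, n, hn, hB⟩ := h' t (hQ s t hs hst)
  have hq := polynomial_eval_mono q ht
  simp only [Polynomial.eval_add, Polynomial.eval_comp]
  exact ⟨u, ⟨t, hst, htu⟩, by omega, m + n, by omega, hA.seq hB⟩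

theorem PolyTime.ite (c : σ → Prop) (test : (κ → Option Γ) → Prop)
    (hc : ∀ s, P s → ((test fun i => (enc s i).head?) ↔ c s))
    (h : PolyTime enc (fun s => P s ∧ c s) R) (h' : PolyTime enc (fun s => P s ∧ ¬c s) R) :
    PolyTime enc P R := by
  obtain ⟨A, p, h⟩ := h
  obtain ⟨B, q, h'⟩ := h'
  refine ⟨.ite test A B, p + q + 1, fun s hs => ?_⟩
  simp only [Polynomial.eval_add, Polynomial.eval_one]
  by_cases hcs : c s
  · obtain ⟨t, hst, ht, m, hm, hA⟩ := h s ⟨hs, hcs⟩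
    exact ⟨t, hst, by omega, m + 1, by omega, hA.ite_pos ((hc s hs).2 hcs)⟩
  · obtain ⟨t, hst, ht, m, hm, hA⟩ := h' s ⟨hs, hcs⟩
    exact ⟨t, hst, by omega, m + 1, by omega, hA.ite_neg fun h => hcs ((hc s hs).1 h)⟩

/-- A loop runs in polynomial time if its body does, if a polynomially bounded measure `μ`
decreases, and if the size stays below a polynomially bounded `B` that does not increase. -/
theorem PolyTime.loop {G : σ → σ → Prop} (c : σ → Prop) (test : (κ → Option Γ) → Prop)
    (μ B : σ → ℕ) (pB : Polynomial ℕ)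
    (hc : ∀ s, P s → ((test fun i => (enc s i).head?) ↔ c s))
    (body : PolyTime enc (fun s => P s ∧ c s) R)
    (inv : ∀ s t, P s → c s → R s t → P t ∧ μ t < μ s ∧ B t ≤ B s)
    (hB : ∀ s, P s → size enc s ≤ B s ∧ μ s ≤ B s ∧ B s ≤ pB.eval (size enc s))
    (exit : ∀ s, P s → ¬c s → G s s)
    (step : ∀ s t u, P s → c s → R s t → G t u → G s u) : PolyTime enc P G := by
  obtain ⟨A, p, h⟩ := body
  have key : ∀ N b s, P s → μ s ≤ N → B s ≤ b → ∃ u, G s u ∧ size enc u ≤ b ∧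
      ∃ n ≤ N * (p.eval b + 1) + 1, (Prog.loop test A).Does (enc s) n (enc u) := by
    intro N b
    induction N with
    | zero =>
      intro s hs hμ hb
      have hcs : ¬c s := by
        intro hcs
        obtain ⟨t, hst, -⟩ := h s ⟨hs, hcs⟩
        have := (inv s t hs hcs hst).2.1
        omega
      exact ⟨s, exit s hs hcs, (hB s hs).1.trans hb, 1, by omega,
        .loop_exit fun h => hcs ((hc s hs).1 h)⟩
    | succ N ih =>
      intro s hs hμ hb
      by_cases hcs : c s
      · obtain ⟨t, hst, -, m, hm, hA⟩ := h s ⟨hs, hcs⟩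
        obtain ⟨h1, h2, h3⟩ := inv s t hs hcs hst
        obtain ⟨u, htu, hu, n, hn, hL⟩ := ih t h1 (by omega) (h3.trans hb)
        have hm' := hm.trans (polynomial_eval_mono p ((hB s hs).1.trans hb))
        refine ⟨u, step s t u hs hcs hst htu, hu, m + n + 1, ?_, hA.loop_step ((hc s hs).2 hcs) hL⟩
        rw [Nat.succ_mul]
        omega
      · exact ⟨s, exit s hs hcs, (hB s hs).1.trans hb, 1, by omega,
          .loop_exit fun h => hcs ((hc s hs).1 h)⟩
  refine ⟨.loop test A, pB * (p.comp pB + 1) + 1 + pB, fun s hs => ?_⟩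
  obtain ⟨h1, h2, h3⟩ := hB s hs
  obtain ⟨u, hu, hu', n, hn, hL⟩ := key _ _ s hs (h2.trans h3) h3
  simp only [Polynomial.eval_add, Polynomial.eval_mul, Polynomial.eval_comp, Polynomial.eval_one]
  exact ⟨u, hu, by omega, n, by omega, hL⟩

theorem PolyTime.edit {f : σ → σ} (e : κ → Prog.Edit Γ)
    (h : ∀ s, P s → ∀ i, enc (f s) i = (e i).apply (enc s i)) :
    PolyTime enc P fun s s' => s' = f s := by
  refine ⟨.edit e, Polynomial.X + Polynomial.C (Fintype.card κ) + 2,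
    fun s hs => ⟨f s, rfl, ?_, 2, ?_, ?_⟩⟩
  · have : size enc (f s) ≤ ∑ i, ((enc s i).length + 1) := by
      refine Finset.sum_le_sum fun i _ => ?_
      rw [h s hs i]
      cases e i <;> simp [Prog.Edit.apply]
      omega
    rw [Finset.sum_add_distrib] at this
    simp only [Finset.sum_const, Finset.card_univ, smul_eq_mul, mul_one] at this
    simp only [Polynomial.eval_add, Polynomial.eval_X, Polynomial.eval_C, Polynomial.eval_ofNat]
    exact this.trans (by simp [size])
  · simp
  · rw [show enc (f s) = fun i => (e i).apply (enc s i) from funext (h s hs)]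
    exact Prog.edit_does e (enc s)

end PolyTime

/-! ### A program for the distribution function -/

/-- The contents of the stacks of the program: the input `x`, the words `v` and `w`, the output `y`,
and eight counters. The quotient to be computed is `(m + 0.w) / n`, and `k` is the number of digits
still to be found; `l` runs through the possible preimages of the length of the input, `a` and `b`
hold the values compared in this search, and `t` and `c` are empty except during the arithmetic. -/
structure Store where
  x : List (Option Bool)
  v : List Bool
  w : List Bool
  y : List Bool
  k : ℕ
  n : ℕ
  m : ℕ
  l : ℕ
  a : ℕ
  b : ℕ
  t : ℕ
  c : ℕ

namespace Store

/-- The stacks, over the tape alphabet `Option Bool`. A counter is a stack of marks; the mark is the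
letter `none`, which is not the blank of the tape. -/
def enc (s : Store) : Fin 12 → List (Option Bool) :=
  ![s.x, s.v.map some, s.w.map some, s.y.map some, List.replicate s.k none,
    List.replicate s.n none, List.replicate s.m none, List.replicate s.l none,
    List.replicate s.a none, List.replicate s.b none, List.replicate s.t none,
    List.replicate s.c none]

theorem size_eq (s : Store) : size enc s = s.x.length + s.v.length + s.w.length + s.y.length +
    s.k + s.n + s.m + s.l + s.a + s.b + s.t + s.c := by
  simp [size, enc, Fin.sum_univ_succ]
  omega

/-- The edits in the list `l`, all other stacks are kept. -/
def edits (l : List (Fin 12 × Prog.Edit (Option Bool))) (i : Fin 12) : Prog.Edit (Option Bool) :=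
  (l.lookup i).getD .keep

/-- On the states with the property `P`, the function `f` is computable in polynomial time. -/
def PolyFun (P : Store → Prop) (f : Store → Store) : Prop :=
  PolyTime enc P fun s s' => s' = f s

variable {P Q : Store → Prop} {f g h : Store → Store}

theorem PolyFun.comp (hf : PolyFun P f) (hg : PolyFun Q g) (hQ : ∀ s, P s → Q (f s))
    (he : ∀ s, P s → h s = g (f s)) : PolyFun P h := by
  refine (PolyTime.seq hf hg fun s t hs ht => ht ▸ hQ s hs).mono (fun _ h => h) ?_
  rintro s _ hs ⟨_, rfl, rfl⟩
  exact (he s hs).symm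

theorem PolyFun.mono (hf : PolyFun P f) (hQ : ∀ s, Q s → P s) (he : ∀ s, Q s → g s = f s) :
    PolyFun Q g :=
  PolyTime.mono hf hQ fun s _ hs h => h.trans (he s hs).symm

theorem PolyFun.edit (e : List (Fin 12 × Prog.Edit (Option Bool)))
    (he : ∀ s, P s → ∀ i, enc (f s) i = (edits e i).apply (enc s i)) : PolyFun P f :=
  PolyTime.edit (edits e) he

theorem PolyFun.ite (i : Fin 12) (hf : PolyFun (fun s => P s ∧ enc s i = []) f)
    (hg : PolyFun (fun s => P s ∧ enc s i ≠ []) f) : PolyFun P f := by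
  refine PolyTime.ite (fun s => enc s i = []) (fun r => r i = none) (fun s _ => ?_) hf hg
  simp

theorem PolyFun.ite_head (i : Fin 12) (a : Option Bool)
    (hf : PolyFun (fun s => P s ∧ (enc s i).head? = some a) f)
    (hg : PolyFun (fun s => P s ∧ (enc s i).head? ≠ some a) f) : PolyFun P f :=
  PolyTime.ite (fun s => (enc s i).head? = some a) (fun r => r i = some a) (fun _ _ => .rfl) hf hg

/-- While neither stack `i` nor stack `j` is empty, apply the edits `e`, which pop stack `i`. -/
theorem PolyFun.transfer (i j : Fin 12) (e : List (Fin 12 × Prog.Edit (Option Bool)))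
    (f : Store → Store) (hi : edits e i = .pop)
    (hf : ∀ s, enc s i ≠ [] → enc s j ≠ [] → ∀ r, enc (f s) r = (edits e r).apply (enc s r))
    (h0 : ∀ s, enc s i = [] ∨ enc s j = [] → g s = s)
    (h1 : ∀ s, enc s i ≠ [] → enc s j ≠ [] → g (f s) = g s) : PolyFun P g := by
  have key : PolyFun (fun _ => True) g := by
    refine PolyTime.loop (fun s => enc s i ≠ [] ∧ enc s j ≠ []) (fun r => r i ≠ none ∧ r j ≠ none)
      (fun s => (enc s i).length) (fun s => size enc s + 12 * (enc s i).length) (13 * Polynomial.X)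
      (fun s _ => by simp) (R := fun s s' => s' = f s)
      (PolyFun.edit e fun s hs => hf s hs.2.1 hs.2.2) ?_ ?_ ?_ ?_
    · rintro s _ - ⟨hs1, hs2⟩ rfl
      have hpos := List.length_pos_of_ne_nil hs1
      have hlen : (enc (f s) i).length = (enc s i).length - 1 := by
        rw [hf s hs1 hs2, hi]
        simp [Prog.Edit.apply]
      have hsize : size enc (f s) ≤ ∑ r, ((enc s r).length + 1) := by
        refine Finset.sum_le_sum fun r _ => ?_
        rw [hf s hs1 hs2]
        cases edits e r <;> simp [Prog.Edit.apply]
        omega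
      rw [Finset.sum_add_distrib] at hsize
      simp only [Finset.sum_const, Finset.card_univ, Fintype.card_fin, smul_eq_mul] at hsize
      have : size enc s = ∑ r, (enc s r).length := rfl
      exact ⟨trivial, by omega, by omega⟩
    · intro s _
      have := length_le_size enc s i
      simp only [Polynomial.eval_mul, Polynomial.eval_ofNat, Polynomial.eval_X]
      omega
    · intro s _ hs
      exact (h0 s (by tauto)).symm
    · rintro s t u - ⟨hs1, hs2⟩ rfl rfl
      exact h1 s hs1 hs2
  exact key.mono (fun _ _ => trivial) fun _ _ => rfl

/-! ### Arithmetic on counters -/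

theorem inc_a : PolyFun P fun s => { s with a := s.a + 1 } :=
  .edit [(8, .push none)] fun s _ r => by fin_cases r <;> rfl

theorem inc_k : PolyFun P fun s => { s with k := s.k + 1 } :=
  .edit [(4, .push none)] fun s _ r => by fin_cases r <;> rfl

theorem inc_m : PolyFun P fun s => { s with m := s.m + 1 } :=
  .edit [(6, .push none)] fun s _ r => by fin_cases r <;> rfl

theorem inc_n : PolyFun P fun s => { s with n := s.n + 1 } :=
  .edit [(5, .push none)] fun s _ r => by fin_cases r <;> rfl

theorem clear_a : PolyFun P fun s => { s with a := 0 } :=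
  .transfer 8 8 [(8, .pop)]
    (fun s => { s with a := s.a - 1 }) rfl
    (fun s _ _ r => by fin_cases r <;> simp [enc, edits, Prog.Edit.apply, List.lookup])
    (fun s h => by cases s; simp_all [enc])
    (fun s _ _ => rfl)

theorem clear_b : PolyFun P fun s => { s with b := 0 } :=
  .transfer 9 9 [(9, .pop)]
    (fun s => { s with b := s.b - 1 }) rfl
    (fun s _ _ r => by fin_cases r <;> simp [enc, edits, Prog.Edit.apply, List.lookup])
    (fun s h => by cases s; simp_all [enc])
    (fun s _ _ => rfl)

theorem clear_m : PolyFun P fun s => { s with m := 0 } :=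
  .transfer 6 6 [(6, .pop)]
    (fun s => { s with m := s.m - 1 }) rfl
    (fun s _ _ r => by fin_cases r <;> simp [enc, edits, Prog.Edit.apply, List.lookup])
    (fun s h => by cases s; simp_all [enc])
    (fun s _ _ => rfl)

theorem move_a_b : PolyFun P fun s => { s with a := 0, b := s.b + s.a } :=
  .transfer 8 8 [(8, .pop), (9, .push none)]
    (fun s => { s with a := s.a - 1, b := s.b + 1 }) rfl
    (fun s _ _ r => by
      fin_cases r <;> simp [enc, edits, Prog.Edit.apply, List.lookup, List.replicate_succ])
    (fun s h => by cases s; simp_all [enc])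
    (fun s h _ => by simp [enc] at h ⊢; omega)

theorem move_a_t : PolyFun P fun s => { s with a := 0, t := s.t + s.a } :=
  .transfer 8 8 [(8, .pop), (10, .push none)]
    (fun s => { s with a := s.a - 1, t := s.t + 1 }) rfl
    (fun s _ _ r => by
      fin_cases r <;> simp [enc, edits, Prog.Edit.apply, List.lookup, List.replicate_succ])
    (fun s h => by cases s; simp_all [enc])
    (fun s h _ => by simp [enc] at h ⊢; omega)

theorem move_l_c_a : PolyFun P fun s => { s with l := 0, c := s.c + s.l, a := s.a + s.l } :=
  .transfer 7 7 [(7, .pop), (11, .push none), (8, .push none)]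
    (fun s => { s with l := s.l - 1, c := s.c + 1, a := s.a + 1 }) rfl
    (fun s _ _ r => by
      fin_cases r <;> simp [enc, edits, Prog.Edit.apply, List.lookup, List.replicate_succ])
    (fun s h => by cases s; simp_all [enc])
    (fun s h _ => by simp [enc] at h ⊢; omega)

theorem move_c_l : PolyFun P fun s => { s with c := 0, l := s.l + s.c } :=
  .transfer 11 11 [(11, .pop), (7, .push none)]
    (fun s => { s with c := s.c - 1, l := s.l + 1 }) rfl
    (fun s _ _ r => by
      fin_cases r <;> simp [enc, edits, Prog.Edit.apply, List.lookup, List.replicate_succ])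
    (fun s h => by cases s; simp_all [enc])
    (fun s h _ => by simp [enc] at h ⊢; omega)

theorem move_n_t_b : PolyFun P fun s => { s with n := 0, t := s.t + s.n, b := s.b + s.n } :=
  .transfer 5 5 [(5, .pop), (10, .push none), (9, .push none)]
    (fun s => { s with n := s.n - 1, t := s.t + 1, b := s.b + 1 }) rfl
    (fun s _ _ r => by
      fin_cases r <;> simp [enc, edits, Prog.Edit.apply, List.lookup, List.replicate_succ])
    (fun s h => by cases s; simp_all [enc])
    (fun s h _ => by simp [enc] at h ⊢; omega)

theorem move_n_t_l : PolyFun P fun s => { s with n := 0, t := s.t + s.n, l := s.l + s.n } :=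
  .transfer 5 5 [(5, .pop), (10, .push none), (7, .push none)]
    (fun s => { s with n := s.n - 1, t := s.t + 1, l := s.l + 1 }) rfl
    (fun s _ _ r => by
      fin_cases r <;> simp [enc, edits, Prog.Edit.apply, List.lookup, List.replicate_succ])
    (fun s h => by cases s; simp_all [enc])
    (fun s h _ => by simp [enc] at h ⊢; omega)

theorem move_t_n : PolyFun P fun s => { s with t := 0, n := s.n + s.t } :=
  .transfer 10 10 [(10, .pop), (5, .push none)]
    (fun s => { s with t := s.t - 1, n := s.n + 1 }) rfl
    (fun s _ _ r => by
      fin_cases r <;> simp [enc, edits, Prog.Edit.apply, List.lookup, List.replicate_succ])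
    (fun s h => by cases s; simp_all [enc])
    (fun s h _ => by simp [enc] at h ⊢; omega)

theorem move_l_m : PolyFun P fun s => { s with l := 0, m := s.m + s.l } :=
  .transfer 7 7 [(7, .pop), (6, .push none)]
    (fun s => { s with l := s.l - 1, m := s.m + 1 }) rfl
    (fun s _ _ r => by
      fin_cases r <;> simp [enc, edits, Prog.Edit.apply, List.lookup, List.replicate_succ])
    (fun s h => by cases s; simp_all [enc])
    (fun s h _ => by simp [enc] at h ⊢; omega)

theorem move_m_t_c : PolyFun P fun s => { s with m := 0, t := s.t + s.m, c := s.c + s.m } :=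
  .transfer 6 6 [(6, .pop), (10, .push none), (11, .push none)]
    (fun s => { s with m := s.m - 1, t := s.t + 1, c := s.c + 1 }) rfl
    (fun s _ _ r => by
      fin_cases r <;> simp [enc, edits, Prog.Edit.apply, List.lookup, List.replicate_succ])
    (fun s h => by cases s; simp_all [enc])
    (fun s h _ => by simp [enc] at h ⊢; omega)

theorem move_t_m : PolyFun P fun s => { s with t := 0, m := s.m + s.t } :=
  .transfer 10 10 [(10, .pop), (6, .push none)]
    (fun s => { s with t := s.t - 1, m := s.m + 1 }) rfl
    (fun s _ _ r => by
      fin_cases r <;> simp [enc, edits, Prog.Edit.apply, List.lookup, List.replicate_succ])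
    (fun s h => by cases s; simp_all [enc])
    (fun s h _ => by simp [enc] at h ⊢; omega)

theorem move_c_m : PolyFun P fun s => { s with c := 0, m := s.m + s.c } :=
  .transfer 11 11 [(11, .pop), (6, .push none)]
    (fun s => { s with c := s.c - 1, m := s.m + 1 }) rfl
    (fun s _ _ r => by
      fin_cases r <;> simp [enc, edits, Prog.Edit.apply, List.lookup, List.replicate_succ])
    (fun s h => by cases s; simp_all [enc])
    (fun s h _ => by simp [enc] at h ⊢; omega)

theorem move_t_n_m : PolyFun P fun s => { s with t := 0, n := s.n + s.t, m := s.m + s.t } :=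
  .transfer 10 10 [(10, .pop), (5, .push none), (6, .push none)]
    (fun s => { s with t := s.t - 1, n := s.n + 1, m := s.m + 1 }) rfl
    (fun s _ _ r => by
      fin_cases r <;> simp [enc, edits, Prog.Edit.apply, List.lookup, List.replicate_succ])
    (fun s h => by cases s; simp_all [enc])
    (fun s h _ => by simp [enc] at h ⊢; omega)

theorem cancel_a_b : PolyFun P fun s => { s with a := s.a - s.b, b := s.b - s.a } :=
  .transfer 8 9 [(8, .pop), (9, .pop)]
    (fun s => { s with a := s.a - 1, b := s.b - 1 }) rfl
    (fun s _ _ r => by fin_cases r <;> simp [enc, edits, Prog.Edit.apply, List.lookup])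
    (fun s h => by cases s; simp_all [enc]; omega)
    (fun s h h' => by simp [enc] at h h' ⊢; omega)

theorem cancel_m_n : PolyFun P fun s => { s with m := s.m - s.n, n := s.n - s.m } :=
  .transfer 6 5 [(6, .pop), (5, .pop)]
    (fun s => { s with m := s.m - 1, n := s.n - 1 }) rfl
    (fun s _ _ r => by fin_cases r <;> simp [enc, edits, Prog.Edit.apply, List.lookup])
    (fun s h => by cases s; simp_all [enc]; omega)
    (fun s h h' => by simp [enc] at h h' ⊢; omega)

theorem cancel_n_m_t :
    PolyFun P fun s => { s with n := s.n - s.m, m := s.m - s.n, t := s.t + min s.n s.m } :=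
  .transfer 5 6 [(5, .pop), (6, .pop), (10, .push none)]
    (fun s => { s with n := s.n - 1, m := s.m - 1, t := s.t + 1 }) rfl
    (fun s _ _ r => by
      fin_cases r <;> simp [enc, edits, Prog.Edit.apply, List.lookup, List.replicate_succ])
    (fun s h => by cases s; simp_all [enc]; omega)
    (fun s h h' => by simp [enc] at h h' ⊢; omega)

theorem clear_w : PolyFun P fun s => { s with w := [] } :=
  .transfer 2 2 [(2, .pop)]
    (fun s => { s with w := s.w.tail }) rfl
    (fun s _ _ r => by fin_cases r <;> simp [enc, edits, Prog.Edit.apply, List.lookup])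
    (fun s h => by cases s; simp_all [enc])
    (fun s _ _ => rfl)

theorem mul_a_l : PolyFun (fun s => s.t = 0 ∧ s.c = 0) fun s => { s with a := s.a * s.l } := by
  -- one round of the loop: add `l` to `a`, by way of `c`
  have body : PolyFun (fun s => s.c = 0 ∧ enc s 10 ≠ [])
      fun s => { s with t := s.t - 1, a := s.a + s.l } := by
    have pop : PolyFun (fun s => s.c = 0 ∧ enc s 10 ≠ [])
        fun s => { s with t := s.t - 1 } :=
      .edit [(10, .pop)] fun s _ r => by
        fin_cases r <;> simp [enc, edits, Prog.Edit.apply, List.lookup]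
    refine (pop.comp (P := fun s => s.c = 0 ∧ enc s 10 ≠ []) (Q := fun s => s.c = 0)
      (.comp (Q := fun s => s.l = 0) move_l_c_a move_c_l (fun s _ => rfl) (fun _ _ => rfl))
      (fun s h => h.1) fun s h => ?_)
    simp [h.1]
  have mul : PolyFun (fun s => s.c = 0)
      fun s => { s with t := 0, a := s.a + s.t * s.l } := by
    refine PolyTime.loop (fun s => enc s 10 ≠ []) (fun r => r 10 ≠ none) (fun s => s.t)
      (fun s => size enc s + s.t * s.l) (Polynomial.X + Polynomial.X * Polynomial.X)
      (fun s _ => by simp) body ?_ ?_ ?_ ?_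
    · rintro s _ hP hs rfl
      have : s.t ≠ 0 := by simpa [enc] using hs
      obtain ⟨t, ht⟩ := Nat.exists_eq_succ_of_ne_zero this
      refine ⟨hP, by simp [ht], ?_⟩
      simp only [size_eq, ht, Nat.succ_eq_add_one, Nat.add_sub_cancel, Nat.add_mul]
      omega
    · intro s _
      have ht : s.t ≤ size enc s := by rw [size_eq]; omega
      have hl : s.l ≤ size enc s := by rw [size_eq]; omega
      refine ⟨by omega, by omega, ?_⟩
      simp only [Polynomial.eval_add, Polynomial.eval_mul, Polynomial.eval_X]
      gcongr
    · intro s _ hs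
      have : s.t = 0 := by simpa [enc] using hs
      cases s
      simp_all
    · rintro s _ _ - hs rfl rfl
      have : s.t ≠ 0 := by simpa [enc] using hs
      obtain ⟨t, ht⟩ := Nat.exists_eq_succ_of_ne_zero this
      simp [ht, Nat.succ_mul]
      ring
  refine move_a_t.comp (Q := fun s => s.c = 0) mul (fun s h => h.2) fun s h => ?_
  simp [h.1]

theorem add_a (r : ℕ) : PolyFun P fun s => { s with a := s.a + r } := by
  induction r with
  | zero => exact PolyTime.skip
  | succ r ih => exact ih.comp (Q := fun _ => True) inc_a (fun _ _ => trivial) fun _ _ => rfl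

/-- Evaluation of a polynomial, by Horner's scheme. -/
theorem eval_a (p : Polynomial ℕ) :
    PolyFun (fun s => s.t = 0 ∧ s.c = 0) fun s => { s with a := p.eval s.l } := by
  induction p using Polynomial.recOnHorner with
  | M0 => simpa using clear_a
  | MC p r _ _ ih =>
    exact ih.comp (Q := fun _ => True) (add_a r) (fun _ _ => trivial) fun _ _ => by simp
  | MX p _ ih => exact ih.comp mul_a_l (fun s h => h) fun s _ => by simp

theorem add_b (r : ℕ) :
    PolyFun (fun s => s.t = 0) fun s => { s with b := s.b + r * s.n } := by
  induction r with
  | zero => exact PolyFun.mono PolyTime.skip (fun _ h => h) fun s _ => by simp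
  | succ r ih =>
    refine ih.comp (Q := fun s => s.t = 0) (move_n_t_b.comp (Q := fun s => s.n = 0) move_t_n
      (h := fun s => { s with b := s.b + s.n }) (fun _ _ => rfl) fun s hs => ?_)
      (fun _ h => h) fun s _ => ?_
    · simp [hs]
    · simp [Nat.succ_mul, Nat.add_assoc]

/-- Compare the values of two polynomial expressions: `a` and `b` become `0` if they are equal. -/
theorem compare (p q : Polynomial ℕ) (r : ℕ) : PolyFun (fun s => s.t = 0 ∧ s.c = 0) fun s =>
    { s with
      a := p.eval s.l - (q.eval s.l + r * s.n)
      b := q.eval s.l + r * s.n - p.eval s.l } := by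
  have h1 : PolyFun (fun s => s.t = 0 ∧ s.c = 0)
      fun s => { s with a := 0, b := q.eval s.l } :=
    (eval_a q).comp (Q := fun _ => True) (clear_b.comp (Q := fun s => s.b = 0) move_a_b
      (fun _ _ => rfl) fun _ _ => rfl) (fun _ _ => trivial) fun s _ => by simp
  have h2 : PolyFun (fun s => s.t = 0 ∧ s.c = 0)
      fun s => { s with a := p.eval s.l, b := s.b + r * s.n } :=
    ((add_b r).mono (fun _ h => h.1) fun _ _ => rfl).comp (eval_a p) (fun _ h => h) fun _ _ => rfl
  exact h1.comp (h2.comp (Q := fun _ => True) cancel_a_b (fun _ _ => trivial) fun _ _ => rfl)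
    (fun _ h => h) fun _ _ => rfl

end Store

namespace Store

variable {P : Store → Prop}

/-! ### Searching for a preimage -/

/-- By trying `l = n, n - 1, …`, search for the greatest positive `l ≤ n` such that `p(l) = q(l) +
r n`; if there is none, the result is `l = 0`. -/
theorem search (p q : Polynomial ℕ) (r : ℕ) :
    PolyTime enc (fun s => s.t = 0 ∧ s.c = 0 ∧ s.l = 0) fun s s' =>
      (∃ l a b, s' = { s with l := l, a := a, b := b }) ∧
      (s'.l ≠ 0 → s'.l ≤ s.n ∧ p.eval s'.l = q.eval s'.l + r * s.n) ∧
      (s'.l = 0 → ∀ j, j ≠ 0 → j ≤ s.n → p.eval j ≠ q.eval j + r * s.n) := by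
  -- The counters `a` and `b` hold the differences for the present value of `l`.
  have loop : PolyTime enc (fun s => (s.t = 0 ∧ s.c = 0) ∧
      s.a = p.eval s.l - (q.eval s.l + r * s.n) ∧ s.b = q.eval s.l + r * s.n - p.eval s.l)
      fun s s' => (∃ l a b, s' = { s with l := l, a := a, b := b }) ∧
      (s'.l ≠ 0 → s'.l ≤ s.l ∧ p.eval s'.l = q.eval s'.l + r * s.n) ∧
      (s'.l = 0 → ∀ j, j ≠ 0 → j ≤ s.l → p.eval j ≠ q.eval j + r * s.n) := by
    refine PolyTime.loop (fun s => s.l ≠ 0 ∧ (s.a ≠ 0 ∨ s.b ≠ 0))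
      (fun r => r 7 ≠ none ∧ (r 8 ≠ none ∨ r 9 ≠ none)) (fun s => s.l)
      (fun s => s.x.length + s.v.length + s.w.length + s.y.length +
        s.k + s.n + s.m + s.l + s.t + s.c + (p.eval s.l + (q.eval s.l + r * s.n)))
      (Polynomial.X + (p + (q + Polynomial.C r * Polynomial.X))) (fun s _ => ?_)
      (R := fun s s' => s' = { s with
        l := s.l - 1
        a := p.eval (s.l - 1) - (q.eval (s.l - 1) + r * s.n)
        b := q.eval (s.l - 1) + r * s.n - p.eval (s.l - 1) }) ?_ ?_ ?_ ?_ ?_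
    · simp [enc, List.head?_eq_none_iff, List.replicate_eq_nil_iff]
    · have dec : PolyFun (fun s => s.t = 0 ∧ s.c = 0) fun s => { s with l := s.l - 1 } :=
        .edit [(7, .pop)] fun s _ r => by
          fin_cases r <;> simp [enc, edits, Prog.Edit.apply, List.lookup]
      exact (dec.comp (compare p q r) (fun _ h => h) fun _ _ => rfl).mono (fun _ h => h.1.1)
        fun _ _ => rfl
    · rintro s _ ⟨h1, h2, h3⟩ ⟨h4, h5⟩ rfl
      have hp := polynomial_eval_mono p (Nat.sub_le s.l 1)
      have hq := polynomial_eval_mono q (Nat.sub_le s.l 1)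
      exact ⟨⟨h1, rfl, rfl⟩, by simp only; omega, by simp only; omega⟩
    · rintro s ⟨h1, h2, h3⟩
      have hl : s.l ≤ size enc s := by rw [size_eq]; omega
      have hn : s.n ≤ size enc s := by rw [size_eq]; omega
      have hp := polynomial_eval_mono p hl
      have hq := polynomial_eval_mono q hl
      have hr := Nat.mul_le_mul_left r hn
      refine ⟨by rw [size_eq]; omega, by omega, ?_⟩
      simp only [Polynomial.eval_add, Polynomial.eval_mul, Polynomial.eval_X, Polynomial.eval_C]
      have : s.x.length + s.v.length + s.w.length + s.y.length + s.k + s.n + s.m + s.l + s.t + s.c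
        ≤ size enc s := by rw [size_eq]; omega
      omega
    · rintro s ⟨h1, h2, h3⟩ h4
      exact ⟨⟨s.l, s.a, s.b, rfl⟩, fun h => ⟨le_rfl, by omega⟩, fun h j hj hj' => by omega⟩
    · rintro s _ u ⟨h1, h2, h3⟩ ⟨h4, h5⟩ rfl ⟨⟨l, a, b, rfl⟩, h6, h7⟩
      simp only at h6 h7 ⊢
      refine ⟨⟨l, a, b, rfl⟩, fun h => ⟨by have := h6 h; omega, (h6 h).2⟩, fun h j hj hj' => ?_⟩
      by_cases hjl : j = s.l
      · rw [hjl]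
        omega
      · exact h7 h j hj (by omega)
  have start : PolyFun (fun s => s.t = 0 ∧ s.c = 0 ∧ s.l = 0) fun s =>
      { s with
        l := s.n
        a := p.eval s.n - (q.eval s.n + r * s.n)
        b := q.eval s.n + r * s.n - p.eval s.n } := by
    refine PolyFun.comp (f := fun s => { s with l := s.l + s.n })
      (move_n_t_l.comp (Q := fun s => s.n = 0) move_t_n (h := fun s => { s with
        n := s.n + s.t, t := 0, l := s.l + s.n }) (fun _ _ => rfl) ?_ |>.mono (fun _ h => h) ?_)
      (compare p q r) (fun _ h => ⟨h.1, h.2.1⟩) ?_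
    · intro s _
      simp [Nat.add_comm]
    · rintro s ⟨h, -⟩
      simp [h]
    · rintro s ⟨-, -, h⟩
      simp [h]
  refine (PolyTime.seq start loop ?_).mono (fun _ h => h) ?_
  · rintro s _ ⟨h1, h2, h3⟩ rfl
    exact ⟨⟨h1, h2⟩, rfl, rfl⟩
  · rintro s _ ⟨h1, h2, h3⟩ ⟨_, rfl, ⟨l, a, b, rfl⟩, h4, h5⟩
    exact ⟨⟨l, a, b, rfl⟩, h4, h5⟩

/-! ### Reading the input -/

/-- Move the stack `v`, in reversed order, to the stack `w`, and add its height to `n`. -/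
theorem move_v_w_n : PolyFun P fun s =>
    { s with v := [], w := s.v.reverse ++ s.w, n := s.n + s.v.length } := by
  refine .mono (P := fun _ => True) ?_ (fun _ _ => trivial) fun _ _ => rfl
  refine PolyTime.loop (fun s => s.v ≠ []) (fun r => r 1 ≠ none) (fun s => s.v.length)
    (fun s => size enc s + s.v.length) (2 * Polynomial.X) (fun s _ => by simp [enc])
    (R := fun s s' => s' = { s with v := s.v.tail, w := s.v.headI :: s.w, n := s.n + 1 })
    ?_ ?_ ?_ ?_ ?_
  · refine PolyFun.ite_head 1 (some true)
      (.edit [(1, .pop), (2, .push (some true)), (5, .push none)] ?_)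
      (.edit [(1, .pop), (2, .push (some false)), (5, .push none)] ?_)
    all_goals
      rintro ⟨x, v, w, y, k, n, m, l, a, b, t, c⟩ ⟨⟨-, h1⟩, h2⟩ r
      rcases v with _ | ⟨_ | _, v⟩ <;> simp [enc] at h1 h2
      fin_cases r <;> simp [enc, edits, Prog.Edit.apply, List.lookup, List.replicate_succ]
  · rintro s _ - h rfl
    have := List.length_pos_of_ne_nil h
    simp only [size_eq, List.length_tail, List.length_cons]
    exact ⟨trivial, by omega, by omega⟩
  · intro s _
    simp only [Polynomial.eval_mul, Polynomial.eval_ofNat, Polynomial.eval_X, size_eq]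
    omega
  · intro s _ h
    cases s
    simp_all
  · rintro ⟨x, v, w, y, k, n, m, l, a, b, t, c⟩ _ _ - h rfl rfl
    cases v
    · simp at h
    · simp
      omega

/-- Move the stack `v`, in reversed order, to the stack `y`. -/
theorem move_v_y : PolyFun P fun s => { s with v := [], y := s.v.reverse ++ s.y } := by
  refine .mono (P := fun _ => True) ?_ (fun _ _ => trivial) fun _ _ => rfl
  refine PolyTime.loop (fun s => s.v ≠ []) (fun r => r 1 ≠ none) (fun s => s.v.length)
    (fun s => size enc s) Polynomial.X (fun s _ => by simp [enc])
    (R := fun s s' => s' = { s with v := s.v.tail, y := s.v.headI :: s.y })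
    ?_ ?_ ?_ ?_ ?_
  · refine PolyFun.ite_head 1 (some true)
      (.edit [(1, .pop), (3, .push (some true))] ?_) (.edit [(1, .pop), (3, .push (some false))] ?_)
    all_goals
      rintro ⟨x, v, w, y, k, n, m, l, a, b, t, c⟩ ⟨⟨-, h1⟩, h2⟩ r
      rcases v with _ | ⟨_ | _, v⟩ <;> simp [enc] at h1 h2
      fin_cases r <;> simp [enc, edits, Prog.Edit.apply, List.lookup]
  · rintro s _ - h rfl
    have := List.length_pos_of_ne_nil h
    simp only [size_eq, List.length_tail, List.length_cons]
    exact ⟨trivial, by omega, by omega⟩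
  · intro s _
    simp only [Polynomial.eval_X, size_eq]
    omega
  · intro s _ h
    cases s
    simp_all
  · rintro ⟨x, v, w, y, k, n, m, l, a, b, t, c⟩ _ _ - h rfl rfl
    cases v
    · simp at h
    · simp

/-- Split the input into a word, whose reversal goes to `v`, and the number of marks. -/
theorem parse : PolyFun P fun s =>
    { s with x := [], v := s.x.reduceOption.reverse ++ s.v, k := s.k + s.x.count none } := by
  refine .mono (P := fun _ => True) ?_ (fun _ _ => trivial) fun _ _ => rfl
  refine PolyTime.loop (fun s => s.x ≠ []) (fun r => r 0 ≠ none) (fun s => s.x.length)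
    (fun s => size enc s) Polynomial.X (fun s _ => by simp [enc])
    (R := fun s s' => s' = { s with
      x := s.x.tail
      v := (s.x.take 1).reduceOption ++ s.v
      k := s.k + (s.x.take 1).count none })
    ?_ ?_ ?_ ?_ ?_
  · refine PolyFun.ite_head 0 (some true) (.edit [(0, .pop), (1, .push (some true))] ?_)
      (.ite_head 0 (some false) (.edit [(0, .pop), (1, .push (some false))] ?_)
        (.edit [(0, .pop), (4, .push none)] ?_))
    all_goals
      rintro ⟨x, v, w, y, k, n, m, l, a, b, t, c⟩ h r
      rcases x with _ | ⟨_ | _ | _, x⟩ <;> simp [enc] at h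
      fin_cases r <;>
        simp [enc, edits, Prog.Edit.apply, List.lookup, List.replicate_succ, List.reduceOption]
  · rintro ⟨x, v, w, y, k, n, m, l, a, b, t, c⟩ _ - h rfl
    rcases x with _ | ⟨_ | _, x⟩
    · simp at h
    all_goals
      simp [size_eq, List.reduceOption]
      try omega
  · intro s _
    simp only [Polynomial.eval_X, size_eq]
    omega
  · intro s _ h
    cases s
    simp_all [List.reduceOption]
  · rintro ⟨x, v, w, y, k, n, m, l, a, b, t, c⟩ _ _ - h rfl rfl
    rcases x with _ | ⟨_ | _, x⟩
    · simp at h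
    all_goals
      simp [List.reduceOption]
      try omega

/-- Count the ones in front of the first zero. -/
theorem count_ones : PolyFun P fun s =>
    { s with w := s.w.dropWhile id, m := s.m + (s.w.takeWhile id).length } := by
  refine .mono (P := fun _ => True) ?_ (fun _ _ => trivial) fun _ _ => rfl
  refine PolyTime.loop (fun s => s.w.head? = some true) (fun r => r 2 = some (some true))
    (fun s => s.w.length) (fun s => size enc s) Polynomial.X (fun s _ => ?_)
    (R := fun s s' => s' = { s with w := s.w.tail, m := s.m + 1 }) ?_ ?_ ?_ ?_ ?_
  · rcases s with ⟨x, v, w, y, k, n, m, l, a, b, t, c⟩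
    cases w <;> simp [enc]
  · refine PolyFun.edit [(2, .pop), (6, .push none)] fun s _ r => ?_
    fin_cases r <;> simp [enc, edits, Prog.Edit.apply, List.lookup, List.replicate_succ]
  · rintro ⟨x, v, w, y, k, n, m, l, a, b, t, c⟩ _ - h rfl
    cases w <;> simp [size_eq] at h ⊢
    omega
  · intro s _
    simp only [Polynomial.eval_X, size_eq]
    omega
  · rintro ⟨x, v, w, y, k, n, m, l, a, b, t, c⟩ _ h
    rcases w with _ | ⟨_ | _, w⟩ <;> simp at h ⊢
  · rintro ⟨x, v, w, y, k, n, m, l, a, b, t, c⟩ _ _ - h rfl rfl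
    rcases w with _ | ⟨_ | _, w⟩ <;> simp at h ⊢
    omega

theorem pop_w : PolyFun P fun s => { s with w := s.w.tail } :=
  .edit [(2, .pop)] fun s _ r => by
    fin_cases r <;> simp [enc, edits, Prog.Edit.apply, List.lookup]

end Store

theorem binFrac_nonneg (d : List Bool) : 0 ≤ binFrac d := by
  induction d with
  | nil => exact le_rfl
  | cons b d ih =>
    simp only [binFrac]
    split_ifs <;> linarith

theorem binFrac_le_one (d : List Bool) : binFrac d ≤ 1 := by
  induction d with
  | nil => exact zero_le_one
  | cons b d ih =>
    simp only [binFrac]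
    split_ifs <;> linarith

namespace Store

variable {P : Store → Prop}

/-! ### Long division -/

/-- One step of the long division: `m` is replaced by `2 m` plus the next digit of `w`, from which
`n` is subtracted if possible; the digit of the quotient goes to `v`. -/
def divStep (s : Store) : Store :=
  { s with
    k := s.k - 1
    w := s.w.tail
    m := (2 * s.m + if s.w.head? = some true then 1 else 0) -
      if s.n ≤ 2 * s.m + (if s.w.head? = some true then 1 else 0) then s.n else 0
    v := decide (s.n ≤ 2 * s.m + if s.w.head? = some true then 1 else 0) :: s.v }

theorem double_m : PolyFun (fun s => s.t = 0 ∧ s.c = 0) fun s => { s with m := 2 * s.m } := by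
  refine move_m_t_c.comp (Q := fun s => s.m = 0)
    (move_t_m.comp (Q := fun _ => True) move_c_m (fun _ _ => trivial) fun _ _ => rfl)
    (fun _ _ => rfl) fun s h => ?_
  simp [h.1, h.2]
  omega

theorem divStep_polyFun : PolyFun (fun s => s.t = 0 ∧ s.c = 0) divStep := by
  -- double the remainder and add the next digit
  have digit : PolyFun (fun s => s.t = 0) fun s => { s with
      k := s.k - 1
      w := s.w.tail
      m := s.m + if s.w.head? = some true then 1 else 0 } := by
    refine PolyFun.ite_head 2 (some true)
      (.edit [(2, .pop), (4, .pop), (6, .push none)] ?_) (.edit [(2, .pop), (4, .pop)] ?_)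
    all_goals
      rintro ⟨x, v, w, y, k, n, m, l, a, b, t, c⟩ ⟨-, h⟩ r
      rcases w with _ | ⟨_ | _, w⟩ <;> simp [enc] at h
      all_goals
        fin_cases r <;> simp [enc, edits, Prog.Edit.apply, List.lookup, List.replicate_succ]
  -- subtract `n` from `m` if possible; `t` holds what has to be given back
  have sub : PolyFun (fun s => s.t = 0) fun s => { s with
      m := s.m - if s.n ≤ s.m then s.n else 0
      v := decide (s.n ≤ s.m) :: s.v } := by
    refine cancel_n_m_t.comp (Q := fun _ => True) (g := fun s => { s with
        t := 0
        n := s.n + s.t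
        m := if s.n = 0 then s.m else s.m + s.t
        v := decide (s.n = 0) :: s.v }) ?_ (fun _ _ => trivial) fun s h => ?_
    · refine PolyFun.ite 5 ?_ ?_
      · refine move_t_n.comp (Q := fun _ => True) (g := fun s => { s with v := true :: s.v })
          (.edit [(1, .push (some true))] fun s _ r => ?_) (fun _ _ => trivial) ?_
        · fin_cases r <;> rfl
        · rintro s ⟨-, h⟩
          simp [enc] at h
          simp [h]
      · refine move_t_n_m.comp (Q := fun _ => True) (g := fun s => { s with v := false :: s.v })
          (.edit [(1, .push (some false))] fun s _ r => ?_) (fun _ _ => trivial) ?_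
        · fin_cases r <;> rfl
        · rintro s ⟨-, h⟩
          simp [enc] at h
          simp [h]
    · simp only [h, Nat.zero_add, Nat.sub_eq_zero_iff_le]
      by_cases hnm : s.n ≤ s.m
      · simp [hnm]
      · have : s.m ≤ s.n := by omega
        simp [hnm, Nat.min_eq_right this]
        omega
  refine double_m.comp (Q := fun s => s.t = 0) (digit.comp sub (fun _ h => h) fun _ _ => rfl)
    (fun _ h => h.1) fun s _ => rfl

/-- Long division: the first `k` binary digits of the quotient `(m + 0.w) / n` go to `v`, the last
one on top. The quotient may be `1`, with all digits equal to `1`; hence the error `ε = 1` is not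
excluded. -/
theorem division : PolyTime enc (fun s => (s.t = 0 ∧ s.c = 0) ∧ 0 < s.n ∧ s.m + binFrac s.w ≤ s.n)
    fun s s' => ∃ d ε, s'.v = d.reverse ++ s.v ∧ s'.y = s.y ∧ d.length = s.k ∧ 0 ≤ ε ∧ ε ≤ 1 ∧
      (s.m + binFrac s.w) / s.n = binFrac d + ε * (1 / 2) ^ s.k := by
  refine PolyTime.loop (fun s => s.k ≠ 0) (fun r => r 4 ≠ none) (fun s => s.k)
    (fun s => s.x.length + s.v.length + s.w.length + s.y.length +
        s.k + 2 * s.n + s.l + s.a + s.b + s.t + s.c) (2 * Polynomial.X) (fun s _ => by simp [enc])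
    (R := fun s s' => s' = divStep s) ?_ ?_ ?_ ?_ ?_
  · exact PolyFun.mono divStep_polyFun (fun _ h => h.1.1) fun _ _ => rfl
  · rintro s _ ⟨h1, h2, h3⟩ h4 rfl
    refine ⟨⟨h1, h2, ?_⟩, by simp only [divStep]; omega, ?_⟩
    · have key : ∀ (r : ℕ) (x : ℝ), (r : ℝ) + x ≤ 2 * s.n → x ≤ 1 →
          ((r - if s.n ≤ r then s.n else 0 : ℕ) : ℝ) + x ≤ s.n := by
        intro r x hr hx
        split_ifs with h
        · push_cast [h]
          linarith
        · have : (r : ℝ) + 1 ≤ s.n := by exact_mod_cast Nat.lt_of_not_le h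
          simp only [Nat.sub_zero]
          linarith
      refine key _ (binFrac s.w.tail) ?_ (binFrac_le_one _)
      rcases hw : s.w with _ | ⟨_ | _, w⟩ <;> simp [hw, binFrac, -Nat.cast_le] at h3 ⊢ <;> linarith
    · simp only [divStep, List.length_tail, List.length_cons]
      omega
  · rintro s ⟨h1, h2, h3⟩
    have hm : s.m ≤ s.n := by
      have := binFrac_nonneg s.w
      exact_mod_cast (by linarith : (s.m : ℝ) ≤ s.n)
    simp only [size_eq, Polynomial.eval_mul, Polynomial.eval_ofNat, Polynomial.eval_X]
    omega
  · rintro s ⟨h1, h2, h3⟩ h4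
    have hn : (0 : ℝ) < s.n := by exact_mod_cast h2
    have hk : s.k = 0 := by omega
    refine ⟨[], (s.m + binFrac s.w) / s.n, rfl, rfl, hk.symm, ?_, ?_, by simp [hk, binFrac]⟩
    · have := binFrac_nonneg s.w
      positivity
    · rwa [div_le_one hn]
  · rintro s _ u ⟨h1, h2, h3⟩ h4 rfl ⟨d, ε, hv, hy, hd, h0, h1', he⟩
    refine ⟨decide (s.n ≤ 2 * s.m + if s.w.head? = some true then 1 else 0) :: d, ε, ?_, hy, ?_,
      h0, h1', ?_⟩
    · rw [hv]
      simp [divStep]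
    · simp only [List.length_cons, hd, divStep]
      omega
    · have hn : (s.n : ℝ) ≠ 0 := by positivity
      obtain ⟨k, hk⟩ := Nat.exists_eq_succ_of_ne_zero h4
      have key : ∀ r : ℕ, ((r - if s.n ≤ r then s.n else 0 : ℕ) : ℝ) =
          r - (if decide (s.n ≤ r) = true then 1 else 0) * s.n := by
        intro r
        by_cases h : s.n ≤ r <;> simp [h]
      have hw : (2 : ℝ) * s.m + (if s.w.head? = some true then 1 else 0) + binFrac s.w.tail =
          2 * (s.m + binFrac s.w) := by
        rcases s.w with _ | ⟨_ | _, w⟩ <;> simp [binFrac] <;> ring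
      simp only [divStep, hk, Nat.succ_eq_add_one, Nat.add_sub_cancel] at he
      rw [key] at he
      push_cast at he
      simp only [binFrac, hk, pow_succ, Nat.succ_eq_add_one]
      rw [div_eq_iff hn] at he ⊢
      linear_combination he / 2 - hw / 2

/-! ### The program -/

/-- Prepare the quotient. Let `w'` be the tail of `w`. If `l = 0`, the quotient is `(m + 0.w') /
n`, where `n = 0` is replaced by `1`. Otherwise it is `0`, `0.w'` or `1`, according to whether `m
+ l` is less than, equal to or greater than `n`. -/
def adjust (s : Store) : Store :=
  if s.l = 0 then { s with w := s.w.tail, n := max s.n 1 }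
  else if s.m + s.l < s.n then { s with l := 0, m := 0, n := s.n - (s.m + s.l), w := [] }
  else if s.n < s.m + s.l then { s with l := 0, m := 1, n := 1, w := [] }
  else { s with l := 0, m := 0, n := 1, w := s.w.tail }

theorem adjust_polyFun : PolyFun P adjust := by
  refine .mono (P := fun _ => True) ?_ (fun _ _ => trivial) fun _ _ => rfl
  refine .ite 7 ?_ ?_
  · refine pop_w.comp (Q := fun _ => True) (g := fun s => { s with n := max s.n 1 })
      (.ite 5 (inc_n.mono (P := fun _ => True) (fun _ _ => trivial) ?_)
        (PolyFun.mono (P := fun _ => True) PolyTime.skip (fun _ _ => trivial) ?_))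
      (fun _ _ => trivial) ?_
    · rintro s ⟨-, h⟩
      simp [enc] at h
      simp [h]
    · rintro s ⟨-, h⟩
      simp [enc] at h
      cases s
      simp at h ⊢
      omega
    · rintro s ⟨-, h⟩
      simp [enc] at h
      simp [adjust, h]
  · refine PolyFun.comp (f := fun s =>
        { s with l := 0, m := s.m + s.l - s.n, n := s.n - (s.m + s.l) })
      (Q := fun _ => True) (g := fun s =>
        if s.m ≠ 0 then { s with m := 1, n := s.n + 1, w := [] } else
        if s.n ≠ 0 then { s with w := [] } else { s with n := 1, w := s.w.tail })
      (move_l_m.comp (Q := fun _ => True) cancel_m_n (fun _ _ => trivial) fun _ _ => rfl)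
      (.ite 6 (.ite 5 ?_ ?_) ?_) (fun _ _ => trivial) ?_
    · refine pop_w.comp (Q := fun _ => True) inc_n (fun _ _ => trivial) ?_
      rintro s ⟨⟨-, h1⟩, h2⟩
      simp [enc] at h1 h2
      simp [h1, h2]
    · refine clear_w.mono (P := fun _ => True) (fun _ _ => trivial) ?_
      rintro s ⟨⟨-, h1⟩, h2⟩
      simp [enc] at h1 h2
      simp [h1, h2]
    · refine clear_m.comp (Q := fun _ => True) (inc_m.comp (Q := fun _ => True)
        (inc_n.comp (Q := fun _ => True) clear_w (fun _ _ => trivial) fun _ _ => rfl)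
        (fun _ _ => trivial) fun _ _ => rfl) (fun _ _ => trivial) ?_
      rintro s ⟨-, h⟩
      simp [enc] at h
      simp [h]
    · rintro s ⟨-, h⟩
      simp [enc] at h
      simp only [adjust, h, if_false]
      rcases lt_trichotomy (s.m + s.l) s.n with h1 | h1 | h1
      · have h2 : s.m + s.l - s.n = 0 := by omega
        have h3 : s.n - (s.m + s.l) ≠ 0 := by omega
        simp [h1, h2, h3]
      · simp [h1]
      · have h2 : s.m + s.l - s.n ≠ 0 := by omega
        have h3 : s.n - (s.m + s.l) = 0 := by omega
        simp [h1, h2, h3, h1.not_gt]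

/-- The store in the beginning. -/
def initial (x : List (Option Bool)) : Store := ⟨x, [], [], [], 0, 0, 0, 0, 0, 0, 0, 0⟩

/-- The value that the program approximates on input `u`, if the search has the result `l`. -/
def quotient (u : List Bool) (l : ℕ) : ℝ :=
  if l = 0 then ((u.takeWhile id).length + binFrac (u.dropWhile id).tail) / max u.length 1
  else if (u.takeWhile id).length + l < u.length then 0
  else if u.length < (u.takeWhile id).length + l then 1
  else binFrac (u.dropWhile id).tail

/-- `l` is a possible result of the search for a positive solution `l ≤ n` of `p(l) = q(l) + r n`;
`l = 0` says that there is none. -/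
def SearchResult (p q : Polynomial ℕ) (r n l : ℕ) : Prop :=
  (l ≠ 0 → l ≤ n ∧ p.eval l = q.eval l + r * n) ∧
    (l = 0 → ∀ j, j ≠ 0 → j ≤ n → p.eval j ≠ q.eval j + r * n)

/-- The store after the input, a word `u` and `k` marks, has been read. There will be `k + 1`
digits, so that the truncation error is strictly less than `(1 / 2) ^ k`. -/
def parsed (u : List Bool) (k : ℕ) : Store :=
  ⟨[], [], u.dropWhile id, [], k + 1, u.length, (u.takeWhile id).length, 0, 0, 0, 0, 0⟩

theorem length_takeWhile_add (u : List Bool) :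
    (u.takeWhile id).length + binFrac (u.dropWhile id).tail ≤ u.length := by
  have h : ((u.takeWhile id).length : ℝ) + (u.dropWhile id).length = u.length := by
    exact_mod_cast (by rw [← List.length_append, List.takeWhile_append_dropWhile])
  rcases hu : u.dropWhile id with _ | ⟨b, w⟩
  · simp [hu, binFrac] at h ⊢
    exact h.le
  · have := binFrac_le_one w
    simp [hu] at h ⊢
    linarith [(Nat.cast_nonneg w.length : (0 : ℝ) ≤ w.length)]

theorem adjust_parsed (u : List Bool) (k l a b : ℕ) :
    ∃ m n w l', adjust { parsed u k with l := l, a := a, b := b } =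
        ⟨[], [], w, [], k + 1, n, m, l', a, b, 0, 0⟩ ∧
      0 < n ∧ m + binFrac w ≤ n ∧ (m + binFrac w) / n = quotient u l := by
  have hu := length_takeWhile_add u
  by_cases hl : l = 0
  · refine ⟨_, max u.length 1, (u.dropWhile id).tail, 0, by simp [adjust, parsed, hl],
      by simp, hu.trans (by simp), by simp [quotient, hl]⟩
  · rcases lt_trichotomy ((u.takeWhile id).length + l) u.length with h | h | h
    · refine ⟨0, u.length - ((u.takeWhile id).length + l), [], 0, ?_, by omega, by simp [binFrac],
        by simp [quotient, hl, h, binFrac]⟩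
      simp [adjust, parsed, hl, h]
    · refine ⟨0, 1, (u.dropWhile id).tail, 0, ?_, one_pos, by simp [binFrac_le_one],
        by simp [quotient, hl, h]⟩
      simp [adjust, parsed, hl, h]
    · refine ⟨1, 1, [], 0, ?_, one_pos, by simp [binFrac],
        by simp [quotient, hl, h, h.not_gt, binFrac]⟩
      simp [adjust, parsed, hl, h, h.not_gt]

theorem read_input : PolyFun
    (fun s => ∃ (u : List Bool) (k : ℕ), s = initial (u.map some ++ List.replicate k none))
    fun s => parsed s.x.reduceOption (s.x.count none) := by
  refine parse.comp (Q := fun _ => True) (inc_k.comp (Q := fun _ => True)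
    (move_v_w_n.comp (Q := fun _ => True) count_ones (fun _ _ => trivial) fun _ _ => rfl)
    (fun _ _ => trivial) fun _ _ => rfl) (fun _ _ => trivial) ?_
  rintro _ ⟨u, k, rfl⟩
  simp [initial, parsed]

theorem reduceOption_input (u : List Bool) (k : ℕ) :
    (u.map some ++ List.replicate k none).reduceOption = u := by
  simp [List.reduceOption]

theorem count_input (u : List Bool) (k : ℕ) :
    (u.map some ++ List.replicate k none).count none = k := by
  have : (u.map some).count (none : Option Bool) = 0 := by simp [List.count_eq_zero]
  simp [List.count_append, this]

/-- The whole program: read the input, search for a solution `l` of `p(l) = q(l) + r n`, and write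
the first digits of `quotient u l`. -/
theorem program (p q : Polynomial ℕ) (r : ℕ) : PolyTime enc
    (fun s => ∃ (u : List Bool) (k : ℕ), s = initial (u.map some ++ List.replicate k none))
    fun s s' => ∀ (u : List Bool) (k : ℕ), s = initial (u.map some ++ List.replicate k none) →
      ∃ l, SearchResult p q r u.length l ∧ |quotient u l - binFrac s'.y| < (1 / 2) ^ k := by
  have searched := (PolyTime.seq (search p q r) (adjust_polyFun (P := fun _ => True))
    fun _ _ _ _ => trivial).mono (P' := fun s => ∃ u k, s = parsed u k) (R' := fun s s' =>
      ∀ u k, s = parsed u k → ∃ l, SearchResult p q r u.length l ∧ ∃ m n w l' a b,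
        s' = ⟨[], [], w, [], k + 1, n, m, l', a, b, 0, 0⟩ ∧
        0 < n ∧ m + binFrac w ≤ n ∧ (m + binFrac w) / n = quotient u l) ?_ ?_
  · have digits := PolyTime.seq searched (PolyTime.seq division
      (move_v_y (P := fun _ => True)) fun _ _ _ _ => trivial) ?_
    · refine (PolyTime.seq read_input digits ?_).mono (fun _ h => h) ?_
      · rintro _ _ ⟨u, k, rfl⟩ rfl
        exact ⟨_, _, rfl⟩
      · rintro _ s' - ⟨_, rfl, s1, h1, s2, ⟨d, ε, hv, hy, hd, h0, h1', he⟩, rfl⟩ u k rfl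
        simp only [initial, reduceOption_input, count_input] at h1
        obtain ⟨l, hl, m, n, w, l', a, b, rfl, hn, hw, hq⟩ := h1 u k rfl
        refine ⟨l, hl, ?_⟩
        simp only [hv, hy, List.append_nil, List.reverse_reverse] at he ⊢
        rw [← hq, he, add_sub_cancel_left, abs_of_nonneg (by positivity), pow_succ]
        have : (0 : ℝ) < (1 / 2) ^ k := by positivity
        nlinarith
    · rintro _ s ⟨u, k, rfl⟩ h
      obtain ⟨l, hl, m, n, w, l', a, b, rfl, hn, hw, hq⟩ := h u k rfl
      exact ⟨⟨rfl, rfl⟩, hn, hw⟩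
  · rintro _ ⟨u, k, rfl⟩
    exact ⟨rfl, rfl, rfl⟩
  · rintro _ s' - ⟨_, ⟨⟨l, a, b, rfl⟩, h1, h2⟩, rfl⟩ u k rfl
    obtain ⟨m, n, w, l', he, h⟩ := adjust_parsed u k l a b
    exact ⟨l, ⟨h1, h2⟩, m, n, w, l', a, b, he, h⟩

end Store

open Store in
/-- A function is computable in polynomial time if its value at `u` is `quotient u l` for every
possible result `l` of the search for a solution of `p(l) = q(l) + r |u|`. -/
theorem ptimeComputableReal_of_quotient (p q : Polynomial ℕ) (r : ℕ) {φ : List Bool → ℝ}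
    (hφ : ∀ u l, SearchResult p q r u.length l → φ u = quotient u l) : PtimeComputableReal φ := by
  obtain ⟨A, P, hA⟩ := program p q r
  refine ⟨A.toMTM 0 3 (.refl _) .some, Prog.toMTM_deterministic, P, fun u k => ?_⟩
  obtain ⟨s', hs', -, n, hn, hD⟩ := hA _ ⟨u, k, rfl⟩
  obtain ⟨l, hl, hq⟩ := hs' u k rfl
  refine ⟨n, ?_, s'.y, Prog.Does.outputsIn (S := enc s') ?_ rfl, by rwa [hφ u l hl]⟩
  · rwa [size_eq, show (initial (u.map some ++ List.replicate k none)).x.length = u.length + k by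
      simp [initial]] at hn
  · convert hD using 1
    funext i
    fin_cases i <;> simp [enc, initial]

/-! ### Integer-valued polynomials -/

/-- On the natural numbers, a polynomial with integer coefficients is the difference of two
polynomials with natural coefficients. -/
theorem exists_nat_polynomials (Q : Polynomial ℤ) :
    ∃ p q : Polynomial ℕ, ∀ n : ℕ, Q.eval (n : ℤ) + (q.eval n : ℕ) = (p.eval n : ℕ) := by
  induction Q using Polynomial.induction_on' with
  | add P Q hP hQ =>
    obtain ⟨p, q, h⟩ := hP
    obtain ⟨p', q', h'⟩ := hQ
    refine ⟨p + p', q + q', fun n => ?_⟩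
    have := h n
    have := h' n
    simp only [Polynomial.eval_add, Nat.cast_add]
    linarith
  | monomial k a =>
    refine ⟨.monomial k a.toNat, .monomial k (-a).toNat, fun n => ?_⟩
    simp only [Polynomial.eval_monomial, Nat.cast_mul, Nat.cast_pow, ← add_mul]
    congr 1
    omega

/-- Newton's forward difference formula shows that a multiple of an integer-valued polynomial
function has integer coefficients. -/
theorem exists_int_polynomial {g : ℕ → ℕ}
    (hg : ∃ p : Polynomial ℝ, ∀ n : ℕ, (g n : ℝ) = p.eval (n : ℝ)) :
    ∃ (r : ℕ) (Q : Polynomial ℤ), 0 < r ∧ ∀ n : ℕ, (r : ℤ) * g n = Q.eval (n : ℤ) := by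
  obtain ⟨p, hp⟩ := hg
  set f : ℕ → ℤ := fun n => g n with hf
  have cast : ∀ k n : ℕ, (((fwdDiff 1)^[k] f n : ℤ) : ℝ) = (fwdDiff 1)^[k] p.eval (n : ℝ) := by
    intro k
    induction k with
    | zero => intro n; simpa [hf] using hp n
    | succ k ih =>
      intro n
      rw [Function.iterate_succ_apply', Function.iterate_succ_apply', fwdDiff, fwdDiff]
      push_cast
      rw [ih, ih]
      push_cast
      rfl
  have zero : ∀ k, p.natDegree < k → (fwdDiff 1)^[k] f 0 = 0 := by
    intro k hk
    have := cast k 0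
    rw [Polynomial.fwdDiff_iter_eq_zero_of_degree_lt hk] at this
    simpa using this
  set d := p.natDegree
  refine ⟨d.factorial, ∑ k ∈ Finset.range (d + 1),
    Polynomial.C (((d.factorial / k.factorial : ℕ) : ℤ) * (fwdDiff 1)^[k] f 0) *
      descPochhammer ℤ k, Nat.factorial_pos d, fun n => ?_⟩
  have newton := shift_eq_sum_fwdDiff_iter (1 : ℕ) f n 0
  have trunc : ∑ k ∈ Finset.range (n + 1), n.choose k • (fwdDiff 1)^[k] f 0 =
      ∑ k ∈ Finset.range (d + 1), n.choose k • (fwdDiff 1)^[k] f 0 := by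
    rcases le_total n d with h | h
    · refine Finset.sum_subset (Finset.range_mono (by omega)) fun k _ hk => ?_
      rw [Nat.choose_eq_zero_of_lt (by simpa using hk), zero_smul]
    · refine (Finset.sum_subset (Finset.range_mono (by omega)) fun k _ hk => ?_).symm
      rw [zero k (by simpa using hk), smul_zero]
  rw [trunc] at newton
  have hfn : (g n : ℤ) = f (0 + n • 1) := by simp [hf]
  rw [hfn, newton, Finset.mul_sum, Polynomial.eval_finsetSum]
  refine Finset.sum_congr rfl fun k hk => ?_
  have hk' : k ≤ d := by simpa [Nat.lt_succ_iff] using hk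
  have h1 : (d.factorial : ℤ) = (d.factorial / k.factorial : ℕ) * k.factorial := by
    exact_mod_cast (Nat.div_mul_cancel (Nat.factorial_dvd_factorial hk')).symm
  rw [Polynomial.eval_mul, Polynomial.eval_C, descPochhammer_eval_eq_descFactorial,
    Nat.descFactorial_eq_factorial_mul_choose, h1]
  push_cast
  simp only [nsmul_eq_mul]
  ring

/-- The preimages of `n` under `g`, shifted by one, are the solutions of an equation of the form
that the program can solve. -/
theorem exists_equation {g : ℕ → ℕ}
    (hg : ∃ p : Polynomial ℝ, ∀ n : ℕ, (g n : ℝ) = p.eval (n : ℝ)) :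
    ∃ (p q : Polynomial ℕ) (r : ℕ), ∀ l n : ℕ,
      p.eval (l + 1) = q.eval (l + 1) + r * n ↔ g l = n := by
  obtain ⟨r, Q, hr, hQ⟩ := exists_int_polynomial hg
  obtain ⟨p, q, h⟩ := exists_nat_polynomials (Q.comp (Polynomial.X - 1))
  refine ⟨p, q, r, fun l n => ?_⟩
  have h1 := h (l + 1)
  rw [Polynomial.eval_comp] at h1
  simp only [Polynomial.eval_sub, Polynomial.eval_X, Polynomial.eval_one, Nat.cast_add,
    Nat.cast_one, add_sub_cancel_right] at h1
  rw [← hQ l] at h1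
  have h2 : r * g l + q.eval (l + 1) = p.eval (l + 1) := by exact_mod_cast h1
  constructor
  · intro h3
    exact Nat.eq_of_mul_eq_mul_left hr (by omega)
  · rintro rfl
    omega

/-! ### Sums over spheres -/

section SphereSum

variable {α : Type} [Fintype α] {f f' : List α → ℝ} {n : ℕ} {S S' : Set (List α)}

theorem sphereSum_congr (hf : ∀ y, y.length = n → f y = f' y)
    (hS : ∀ y, y.length = n → (y ∈ S ↔ y ∈ S')) : sphereSum f n S = sphereSum f' n S' := by
  classical
  refine Finset.sum_congr rfl fun v _ => ?_
  have hv : (List.ofFn v).length = n := List.length_ofFn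
  simp only [Set.indicator_apply, hf _ hv, hS _ hv]

theorem sphereSum_le (hf : ∀ y, y.length = n → f y ≤ f' y) : sphereSum f n S ≤ sphereSum f' n S :=
  Finset.sum_le_sum fun _ _ => Set.indicator_le_indicator (hf _ List.length_ofFn)

theorem sphereSum_mono_set (hf : ∀ y, 0 ≤ f y) (h : ∀ y, y.length = n → y ∈ S → y ∈ S') :
    sphereSum f n S ≤ sphereSum f n S' := by
  classical
  refine Finset.sum_le_sum fun v _ => ?_
  have := h (List.ofFn v) List.length_ofFn
  have := hf (List.ofFn v)
  simp only [Set.indicator_apply]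
  split_ifs <;> tauto

theorem sphereSum_mul (c : ℝ) : sphereSum (fun y => c * f y) n S = c * sphereSum f n S := by
  classical
  simp only [sphereSum, Finset.mul_sum, Set.indicator_apply, mul_ite, mul_zero]

theorem sphereSum_empty : sphereSum f n (∅ : Set (List α)) = 0 := by
  simp [sphereSum]

theorem sphereSum_indicator : sphereSum (S.indicator f) n Set.univ = sphereSum f n S := by
  simp [sphereSum]

theorem sphereSum_succ (f : List Bool → ℝ) (n : ℕ) (S : Set (List Bool)) :
    sphereSum f (n + 1) S = sphereSum (fun y => f (false :: y)) n {y | false :: y ∈ S} +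
      sphereSum (fun y => f (true :: y)) n {y | true :: y ∈ S} := by
  classical
  simp only [sphereSum]
  rw [← (Fin.consEquiv fun _ : Fin (n + 1) => Bool).sum_comp, Fintype.sum_prod_type,
    Fintype.sum_bool, add_comm]
  simp [Fin.consEquiv, Set.indicator_apply]

/-- The sum of `f` over the words that precede `u` in the shortlex order and have the length of
`u`. -/
def sumBefore (f : List Bool → ℝ) (u : List Bool) : ℝ :=
  sphereSum f u.length {y | List.Shortlex (· < ·) y u}

theorem sumBefore_nil (f : List Bool → ℝ) : sumBefore f [] = 0 := by
  simp [sumBefore, sphereSum, List.not_shortlex_nil_right]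

theorem sumBefore_false (f : List Bool → ℝ) (u : List Bool) :
    sumBefore f (false :: u) = sumBefore (fun y => f (false :: y)) u := by
  rw [sumBefore, List.length_cons, sphereSum_succ]
  have h : sphereSum (fun y => f (true :: y)) u.length
      {y | true :: y ∈ {y | List.Shortlex (· < ·) y (false :: u)}} = 0 := by
    rw [← sphereSum_empty (f := fun y => f (true :: y)) (n := u.length)]
    refine sphereSum_congr (fun _ _ => rfl) fun y hy => ?_
    simp [List.shortlex_def, hy, List.cons_lt_cons_iff]
  rw [h, add_zero]
  exact sphereSum_congr (fun _ _ => rfl) fun y hy => by simp [List.shortlex_cons_iff]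

theorem sumBefore_true (f : List Bool → ℝ) (u : List Bool) :
    sumBefore f (true :: u) = sphereSum (fun y => f (false :: y)) u.length Set.univ +
      sumBefore (fun y => f (true :: y)) u := by
  rw [sumBefore, List.length_cons, sphereSum_succ]
  congr 1
  · refine sphereSum_congr (fun _ _ => rfl) fun y hy => ?_
    simp [List.shortlex_def, hy, List.cons_lt_cons_iff]
  · exact sphereSum_congr (fun _ _ => rfl) fun y hy => by simp [List.shortlex_cons_iff]

end SphereSum

/-! ### The distribution function of the halting ensemble -/

/-- The uniform probability function on each sphere. -/
def uniformProb (y : List Bool) : ℝ := 1 / 2 ^ y.length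

theorem uniformProb_cons (b : Bool) :
    (fun y => uniformProb (b :: y)) = fun y => 1 / 2 * uniformProb y := by
  funext y
  simp [uniformProb, pow_succ, mul_comm]

theorem sphereSum_uniformProb (n : ℕ) : sphereSum uniformProb n Set.univ = 1 := by
  simp [sphereSum, uniformProb]

theorem sumBefore_uniformProb (u : List Bool) : sumBefore uniformProb u = binFrac u := by
  induction u with
  | nil => exact sumBefore_nil _
  | cons b u ih =>
    have h : sumBefore (fun y => 1 / 2 * uniformProb y) u = 1 / 2 * binFrac u := by
      rw [← ih]
      exact sphereSum_mul _
    cases b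
    · rw [sumBefore_false, uniformProb_cons, h, binFrac]
      simp
      ring
    · rw [sumBefore_true, uniformProb_cons, uniformProb_cons, h, sphereSum_mul,
        sphereSum_uniformProb, binFrac]
      simp
      ring

theorem haltingWeight_false (y : List Bool) : haltingWeight (false :: y) = uniformProb y := rfl

theorem haltingWeight_true (y : List Bool) : haltingWeight (true :: y) = haltingWeight y := rfl

theorem sumBefore_haltingWeight (u : List Bool) :
    sumBefore haltingWeight u = (u.takeWhile id).length + binFrac (u.dropWhile id).tail := by
  induction u with
  | nil => simp [sumBefore_nil, binFrac]
  | cons b u ih =>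
    cases b
    · simp only [sumBefore_false, haltingWeight_false]
      simpa using sumBefore_uniformProb u
    · simp only [sumBefore_true, haltingWeight_true, haltingWeight_false]
      have := sphereSum_uniformProb u.length
      change sphereSum (fun y => uniformProb y) _ _ + sumBefore (fun y => haltingWeight y) u = _
      simp only [show (fun y => uniformProb y) = uniformProb from rfl, this, ih,
        show (fun y => haltingWeight y) = haltingWeight from rfl]
      simp
      ring

/-- The probability function that is uniform on the words `1^m 0 w` with `|w| = l`. -/
def guardedWeight (l : ℕ) (y : List Bool) : ℝ :=
  if (y.dropWhile id).length = l + 1 then haltingWeight y else 0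

theorem guardedWeight_false (l : ℕ) (y : List Bool) :
    guardedWeight l (false :: y) = (if y.length = l then 1 else 0) * uniformProb y := by
  simp [guardedWeight, haltingWeight_false]

theorem guardedWeight_true (l : ℕ) :
    (fun y => guardedWeight l (true :: y)) = guardedWeight l := rfl

theorem sphereSum_guardedWeight_false (l n : ℕ) (S : Set (List Bool)) :
    sphereSum (fun y => guardedWeight l (false :: y)) n S =
      (if n = l then 1 else 0) * sphereSum uniformProb n S := by
  rw [← sphereSum_mul]
  refine sphereSum_congr (fun y hy => ?_) fun _ _ => .rfl
  rw [guardedWeight_false, hy]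

theorem sphereSum_guardedWeight (l n : ℕ) :
    sphereSum (guardedWeight l) n Set.univ = if l < n then 1 else 0 := by
  induction n with
  | zero => simp [sphereSum, guardedWeight]
  | succ n ih =>
    rw [sphereSum_succ]
    simp only [Set.mem_univ, Set.ofPred_true]
    rw [sphereSum_guardedWeight_false, sphereSum_uniformProb, guardedWeight_true, ih]
    split_ifs <;> first | omega | simp

theorem sumBefore_guardedWeight (l : ℕ) (u : List Bool) : sumBefore (guardedWeight l) u =
    if (u.takeWhile id).length + (l + 1) < u.length then 0
    else if u.length < (u.takeWhile id).length + (l + 1) then if l < u.length then 1 else 0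
    else binFrac (u.dropWhile id).tail := by
  induction u with
  | nil => simp [sumBefore_nil]
  | cons b u ih =>
    cases b
    · rw [sumBefore_false, sumBefore, sphereSum_guardedWeight_false]
      change _ * sumBefore uniformProb u = _
      rw [sumBefore_uniformProb]
      simp only [List.length_cons]
      rcases lt_trichotomy u.length l with h | h | h
      · simp [h, h.ne, h.not_gt]
      · simp [h]
      · simp [h, h.ne']
    · rw [sumBefore_true, guardedWeight_true, ih, sphereSum_guardedWeight_false,
        sphereSum_uniformProb]
      simp only [List.length_cons, List.takeWhile_cons, List.dropWhile_cons, id, if_true]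
      split_ifs <;> first | omega | simp

/-! ### The restricted ensembles -/

theorem mem_guardedCodes {g : ℕ → ℕ} (hg : StrictMono g) {l : ℕ} {y : List Bool}
    (hy : y.length = g l) : y ∈ guardedCodes g ↔ (y.dropWhile id).length = l + 1 := by
  rcases code_or_replicate y with ⟨m, w, rfl⟩ | ⟨m, rfl⟩
  · rw [dropWhile_code, List.length_cons, Nat.add_right_cancel_iff]
    constructor
    · rintro ⟨m', w', h, h'⟩
      rw [(code_inj h).2]
      exact hg.injective (h'.symm.trans hy)
    · rintro rfl
      exact ⟨m, w, rfl, hy⟩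
  · rw [dropWhile_replicate]
    simp only [List.length_nil, (Nat.succ_ne_zero l).symm, iff_false]
    rintro ⟨m', w', h, -⟩
    exact replicate_ne_code _ _ _ h

theorem not_mem_guardedCodes {g : ℕ → ℕ} {y : List Bool} (h : ∀ l < y.length, g l ≠ y.length) :
    y ∉ guardedCodes g := by
  rintro ⟨m, w, rfl, hw⟩
  exact h w.length (by rw [length_code]; omega) hw.symm

theorem haltingProb_eq {y : List Bool} (hy : y.length ≠ 0) :
    haltingProb y = (1 / (y.length : ℝ)) * haltingWeight y := by
  rcases code_or_replicate y with ⟨m, w, rfl⟩ | ⟨m, rfl⟩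
  · rw [haltingProb_code, haltingWeight, dropWhile_code]
    simp only
    rw [div_mul_div_comm, one_mul]
  · have : List.replicate m true ≠ [] := by
      rintro h
      simp [h] at hy
    rw [haltingProb, haltingWeight, dropWhile_replicate]
    simp [this]

/-- If `n = g(l)` with `l < n`, then the restricted ensemble is uniform on the words `1^m 0 w` of
length `n` with `|w| = l`. -/
theorem induced_prob_of_eq {g : ℕ → ℕ} (hg : StrictMono g) {l n : ℕ} (hl : l < n) (hn : g l = n)
    {y : List Bool} (hy : y.length = n) :
    (haltingEnsemble.induced (guardedCodes g)).prob y = guardedWeight l y := by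
  have hn0 : (n : ℝ) ≠ 0 := by
    have : n ≠ 0 := by omega
    exact_mod_cast this
  have ind : ∀ z : List Bool, z.length = n →
      (guardedCodes g).indicator haltingProb z = 1 / (n : ℝ) * guardedWeight l z := by
    classical
    intro z hz
    rw [Set.indicator_apply, guardedWeight, mem_guardedCodes hg (hz.trans hn.symm)]
    split_ifs
    · rw [haltingProb_eq (by omega), hz]
    · simp
  have hprob : haltingEnsemble.prob = haltingProb := rfl
  have hm : haltingEnsemble.measure n (guardedCodes g) = 1 / n := by
    rw [Ensemble.measure, hprob, ← sphereSum_indicator, sphereSum_congr ind fun _ _ => .rfl,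
      sphereSum_mul, sphereSum_guardedWeight, if_pos hl, mul_one]
  simp only [Ensemble.induced, hy, hm, hprob, ind y hy]
  rw [if_pos (by simpa using hn0)]
  field_simp

theorem induced_prob_of_ne {g : ℕ → ℕ} {y : List Bool} (h : ∀ l < y.length, g l ≠ y.length) :
    (haltingEnsemble.induced (guardedCodes g)).prob y = haltingProb y := by
  have hm : haltingEnsemble.measure y.length (guardedCodes g) = 0 := by
    rw [Ensemble.measure, ← sphereSum_empty (f := haltingEnsemble.prob) (n := y.length)]
    refine sphereSum_congr (fun _ _ => rfl) fun z hz => ?_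
    simp only [Set.mem_empty_iff_false, iff_false]
    exact not_mem_guardedCodes (by rwa [hz])
  simp only [Ensemble.induced, hm]
  simp
  rfl

/-- The restricted ensemble exceeds the halting ensemble by at most a linear factor. -/
theorem induced_prob_le {g : ℕ → ℕ} (hg : StrictMono g) (y : List Bool) :
    (haltingEnsemble.induced (guardedCodes g)).prob y ≤ (y.length + 1) * haltingProb y := by
  have hpos : 0 ≤ haltingProb y := haltingEnsemble.nonneg y
  by_cases h : ∃ l < y.length, g l = y.length
  · obtain ⟨l, hl, hn⟩ := h
    have hy : y.length ≠ 0 := by omega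
    rw [induced_prob_of_eq hg hl hn rfl]
    have hw : haltingWeight y = y.length * haltingProb y := by
      rw [haltingProb_eq hy]
      have : (y.length : ℝ) ≠ 0 := by exact_mod_cast hy
      field_simp
    have : guardedWeight l y ≤ haltingWeight y := by
      rw [guardedWeight]
      split_ifs
      · exact le_rfl
      · rw [hw]
        positivity
    linarith
  · push Not at h
    rw [induced_prob_of_ne h]
    have : (0 : ℝ) ≤ y.length * haltingProb y := by positivity
    linarith

theorem induced_measure_le {g : ℕ → ℕ} (hg : StrictMono g) (n : ℕ) (S : Set (List Bool)) :
    (haltingEnsemble.induced (guardedCodes g)).measure n S ≤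
      (n + 1) * haltingEnsemble.measure n S := by
  rw [Ensemble.measure, Ensemble.measure, ← sphereSum_mul]
  refine sphereSum_le fun y hy => ?_
  have := induced_prob_le hg y
  rwa [hy] at this

/-- The distribution function of the restricted ensemble is the quotient that the program
computes: `l = 0` stands for a length that is not a value of `g` at a smaller argument, and
otherwise `l - 1` is the preimage of the length under `g`. -/
theorem induced_distribution {g : ℕ → ℕ} (hg : StrictMono g) (u : List Bool) (l : ℕ)
    (h1 : l ≠ 0 → l ≤ u.length ∧ g (l - 1) = u.length)
    (h2 : l = 0 → ∀ j < u.length, g j ≠ u.length) :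
    (haltingEnsemble.induced (guardedCodes g)).distribution u = Store.quotient u l := by
  rw [Ensemble.distribution, Ensemble.measure, Store.quotient]
  by_cases hl : l = 0
  · rw [if_pos hl]
    by_cases hu : u.length = 0
    · rw [List.length_eq_zero_iff] at hu
      subst hu
      simp [sphereSum, List.not_shortlex_nil_right, binFrac]
    · have : ∀ y : List Bool, y.length = u.length →
          (haltingEnsemble.induced (guardedCodes g)).prob y =
            1 / (u.length : ℝ) * haltingWeight y := by
        intro y hy
        rw [induced_prob_of_ne (by rw [hy]; exact h2 hl), haltingProb_eq (by omega), hy]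
      rw [sphereSum_congr this fun _ _ => .rfl, sphereSum_mul]
      change _ * sumBefore haltingWeight u = _
      rw [sumBefore_haltingWeight, max_eq_left (Nat.one_le_iff_ne_zero.2 hu)]
      ring
  · obtain ⟨h3, h4⟩ := h1 hl
    obtain ⟨l, rfl⟩ := Nat.exists_eq_succ_of_ne_zero hl
    rw [sphereSum_congr (fun y hy => induced_prob_of_eq hg (by omega) h4 hy) fun _ _ => .rfl,
      if_neg hl]
    change sumBefore (guardedWeight l) u = _
    rw [sumBefore_guardedWeight, if_pos (show l < u.length by omega)]

/-- In a code `u = 1^m 0 w` the word `w` is shorter than `u`, so that a search among the numbers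
below `|u|` finds the preimage of `|u|` under `g` if it matters. -/
theorem restrictedDBH_inDistNP (M : NTM Bool) {g : ℕ → ℕ}
    (hg_poly : ∃ p : Polynomial ℝ, ∀ n : ℕ, (g n : ℝ) = p.eval (n : ℝ)) (hg : StrictMono g) :
    InDistNP (restrictedDBH M g) := by
  obtain ⟨p, q, r, h⟩ := exists_equation hg_poly
  refine ⟨boundedHalting_inNP M, ptimeComputableReal_of_quotient p q r fun u l hl => ?_⟩
  refine induced_distribution hg u l (fun h0 => ?_) fun h0 j hj hgj => ?_
  · obtain ⟨j, rfl⟩ := Nat.exists_eq_succ_of_ne_zero h0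
    exact ⟨(hl.1 h0).1, (h j _).1 (hl.1 h0).2⟩
  · exact hl.2 h0 (j + 1) (Nat.succ_ne_zero j) hj ((h j _).2 hgj)

/-- No word is a guarded code for the identity function, so that `DBH(M)` itself is one of the
restricted problems. -/
theorem restrictedDBH_id (M : NTM Bool) : restrictedDBH M id = DBH M := by
  have : haltingEnsemble.induced (guardedCodes id) = haltingEnsemble := by
    have hp : (haltingEnsemble.induced (guardedCodes id)).prob = haltingEnsemble.prob :=
      funext fun y => induced_prob_of_ne fun l hl => hl.ne
    generalize haltingEnsemble.induced (guardedCodes id) = μ at hp ⊢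
    cases μ
    cases hν : haltingEnsemble
    simp_all
  simp only [restrictedDBH, DistProblem.restrict, DBH, this]

theorem DBH_inDistNP (M : NTM Bool) : InDistNP (DBH M) := by
  rw [← restrictedDBH_id]
  exact restrictedDBH_inDistNP M ⟨Polynomial.X, by simp⟩ strictMono_id

/-! ### The composition of two machines -/

section TapeMap

variable {Γ Γ' : Type}

/-- An embedding of tape alphabets, extended to the blank. -/
def blankMap (f : Γ → Γ') : PointedMap (Option Γ) (Option Γ') := ⟨Option.map f, rfl⟩

theorem map_step (f : Γ → Γ') (T : Tape (Option Γ)) (a : Option Γ) (d : Option Dir) :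
    moveTape d ((T.map (blankMap f)).write (a.map f)) =
      (moveTape d (T.write a)).map (blankMap f) := by
  have h : (T.map (blankMap f)).write (a.map f) = (T.write a).map (blankMap f) :=
    (Tape.map_write (blankMap f) a T).symm
  rw [h]
  cases d with
  | none => rfl
  | some d => exact (Tape.map_move (blankMap f) (T.write a) d).symm

theorem map_keep (f : Γ → Γ') (T : Tape (Option Γ)) (d : Option Dir) :
    moveTape d ((T.map (blankMap f)).write (T.head.map f)) =
      (moveTape d T).map (blankMap f) := by
  rw [map_step, Tape.write_self]

theorem moveTape_none (T : Tape (Option Γ)) : moveTape none T = T := rfl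

theorem moveTape_some (T : Tape (Option Γ)) (d : Dir) : moveTape (some d) T = T.move d := rfl

theorem right₀_map (f : Γ → Γ') (T : Tape (Option Γ)) :
    (T.map (blankMap f)).right₀ = T.right₀.map (blankMap f) := by
  simp [Tape.map, Tape.right₀, blankMap]

theorem listBlank_map_injective {f : Γ → Γ'} (hf : f.Injective) {L L' : ListBlank (Option Γ)}
    (h : L.map (blankMap f) = L'.map (blankMap f)) : L = L' := by
  refine ListBlank.ext fun i => ?_
  have := congrArg (fun L => L.nth i) h
  simp only [ListBlank.nth_map] at this
  exact Option.map_injective hf this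

end TapeMap

namespace MTM

variable {α β γ : Type} {F : MTM α β} {M : MTM β γ}

theorem ReachesIn.of_step {N : MTM α β} {c d : N.Cfg} (h : N.Step c d) : N.ReachesIn 1 c d :=
  ⟨d, h, rfl⟩

theorem Deterministic.comp (hF : F.Deterministic) (hM : M.Deterministic) :
    (M.comp F).Deterministic := by
  -- In each case the state and the symbols read determine the kind of the transition.
  have inl_inj : ∀ {r r' : F.ι → Option F.Γ} {rM rM' : M.ι → Option (F.Γ ⊕ M.Γ)},
      Sum.elim (fun i => (r i).map Sum.inl) rM = Sum.elim (fun i => (r' i).map Sum.inl) rM' →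
      r = r' ∧ rM = rM' := fun h =>
    ⟨funext fun i => Option.map_injective Sum.inl_injective (congrFun h (.inl i)),
      funext fun i => congrFun h (.inr i)⟩
  have inr_inj : ∀ {r r' : M.ι → Option M.Γ} {rF rF' : F.ι → Option (F.Γ ⊕ M.Γ)},
      Sum.elim rF (fun i => (r i).map Sum.inr) = Sum.elim rF' (fun i => (r' i).map Sum.inr) →
      r = r' ∧ rF = rF' := fun h =>
    ⟨funext fun i => Option.map_injective Sum.inr_injective (congrFun h (.inr i)),
      funext fun i => congrFun h (.inl i)⟩
  intro q r q₁ w₁ d₁ q₂ w₂ d₂ h₁ h₂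
  change CompStep F M q r q₁ w₁ d₁ at h₁
  change CompStep F M q r q₂ w₂ d₂ at h₂
  cases h₁ with
  | first rM hq h =>
    generalize hr : Sum.elim _ rM = r at h₂
    cases h₂ with
    | first rM' _ h' =>
      obtain ⟨rfl, rfl⟩ := inl_inj hr
      obtain ⟨rfl, rfl, rfl⟩ := hF _ _ _ _ _ _ _ _ h h'
      exact ⟨rfl, rfl, rfl⟩
    | copy => exact absurd rfl hq
    | turn => exact absurd rfl hq
  | copy _ b hr =>
    cases h₂ with
    | first _ hq => exact absurd rfl hq
    | copy _ b' hr' =>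
      rw [hr] at hr'
      obtain rfl : b = b' := by simpa using hr'
      exact ⟨rfl, rfl, rfl⟩
    | turn _ hr' => simp [hr] at hr'
  | turn _ hr =>
    cases h₂ with
    | first _ hq => exact absurd rfl hq
    | copy _ b' hr' => simp [hr] at hr'
    | turn => exact ⟨rfl, rfl, rfl⟩
  | rewind _ hr =>
    cases h₂ with
    | rewind => exact ⟨rfl, rfl, rfl⟩
    | launch _ hr' => exact absurd hr' hr
  | launch _ hr =>
    cases h₂ with
    | rewind _ hr' => exact absurd hr hr'
    | launch => exact ⟨rfl, rfl, rfl⟩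
  | second rF h =>
    generalize hr : Sum.elim rF _ = r at h₂
    cases h₂ with
    | second rF' h' =>
      obtain ⟨rfl, rfl⟩ := inr_inj hr
      obtain ⟨rfl, rfl, rfl⟩ := hM _ _ _ _ _ _ _ _ h h'
      exact ⟨rfl, rfl, rfl⟩

/-- A configuration of the composition, from the tapes of the two machines, whose alphabets are
embedded into the common one. -/
def compCfg (F : MTM α β) (M : MTM β γ) (q : F.Q ⊕ Unit ⊕ M.Q) (TF : F.ι → Tape (Option F.Γ))
    (TM : M.ι → Tape (Option M.Γ)) : (M.comp F).Cfg :=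
  ⟨q, Sum.elim (fun i => (TF i).map (blankMap Sum.inl)) fun i => (TM i).map (blankMap Sum.inr)⟩

open Classical in
/-- The tapes of `M` when only the input tape has been used. -/
def inputTapes (M : MTM β γ) (T : Tape (Option M.Γ)) : M.ι → Tape (Option M.Γ) :=
  fun i => if i = M.inTape then T else Tape.mk₁ []

theorem init_tape (y : List β) : (M.init y).tape = inputTapes M (wordTape [] (y.map M.inp)) := by
  funext i
  simp only [init, inputTapes, wordTape_nil_left]
  split_ifs <;> simp [Function.comp_def]

theorem comp_init (x : List α) : (M.comp F).init x =
    compCfg F M (.inl F.start) (F.init x).tape (inputTapes M (wordTape [] [])) := by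
  simp only [init, compCfg, Cfg.mk.injEq, true_and]
  funext i
  rcases i with i | i
  · by_cases h : i = F.inTape <;> simp [h, Tape.map_mk₁, blankMap, Function.comp_def]
  · simp only [inputTapes, wordTape_nil, ite_self, reduceCtorEq, if_false, Sum.elim_inr,
      Tape.map_mk₁, List.map_nil]

theorem compCfg_heads (q : F.Q ⊕ Unit ⊕ M.Q) (TF : F.ι → Tape (Option F.Γ))
    (TM : M.ι → Tape (Option M.Γ)) : (fun i => ((compCfg F M q TF TM).tape i).head) =
      Sum.elim (fun i => (TF i).head.map Sum.inl) fun i => (TM i).head.map Sum.inr := by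
  funext i
  cases i <;> rfl

theorem comp_step {q q' : F.Q ⊕ Unit ⊕ M.Q} {TF TF' : F.ι → Tape (Option F.Γ)}
    {TM TM' : M.ι → Tape (Option M.Γ)} {r w : F.ι ⊕ M.ι → Option (F.Γ ⊕ M.Γ)}
    {d : F.ι ⊕ M.ι → Option Dir} (h : CompStep F M q r q' w d) (hq : q ≠ .inr (.inr M.halt))
    (hr : r = Sum.elim (fun i => (TF i).head.map Sum.inl) fun i => (TM i).head.map Sum.inr)
    (hF : ∀ i, (TF' i).map (blankMap Sum.inl) =
      moveTape (d (.inl i)) (((TF i).map (blankMap Sum.inl)).write (w (.inl i))))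
    (hM : ∀ i, (TM' i).map (blankMap Sum.inr) =
      moveTape (d (.inr i)) (((TM i).map (blankMap Sum.inr)).write (w (.inr i)))) :
    (M.comp F).Step (compCfg F M q TF TM) (compCfg F M q' TF' TM') := by
  rw [← compCfg_heads q] at hr
  subst hr
  exact ⟨hq, w, d, h, fun i => i.rec hF hM⟩

theorem comp_step_first {c e : F.Cfg} (h : F.Step c e) (TM : M.ι → Tape (Option M.Γ)) :
    (M.comp F).Step (compCfg F M (.inl c.state) c.tape TM)
      (compCfg F M (.inl e.state) e.tape TM) := by
  obtain ⟨hc, w, d, hδ, he⟩ := h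
  refine comp_step (.first _ hc hδ) (by simp) rfl (fun i => ?_) fun i => ?_
  · simp only [Sum.elim_inl, map_step, he]
  · exact (map_keep _ _ none).symm

theorem comp_reachesIn_first {n : ℕ} {c e : F.Cfg} (h : F.ReachesIn n c e)
    (TM : M.ι → Tape (Option M.Γ)) :
    (M.comp F).ReachesIn n (compCfg F M (.inl c.state) c.tape TM)
      (compCfg F M (.inl e.state) e.tape TM) := by
  induction n generalizing c with
  | zero => cases h; rfl
  | succ n ih =>
    obtain ⟨f, hf, h⟩ := h
    exact ⟨_, comp_step_first hf TM, ih h⟩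

open Classical in
/-- After `F` has halted, its output is copied to the input tape of `M`. -/
theorem comp_copy (y : List β) (v : List M.Γ) (TF : F.ι → Tape (Option F.Γ))
    (hy : (TF F.outTape).right₀ = ListBlank.mk (y.map fun b => some (F.out b))) :
    ∃ TF', (TF' F.outTape).head = none ∧ (M.comp F).ReachesIn y.length
      (compCfg F M (.inl F.halt) TF (inputTapes M (wordTape v [])))
      (compCfg F M (.inl F.halt) TF'
        (inputTapes M (wordTape ((y.map M.inp).reverse ++ v) []))) := by
  induction y generalizing v TF with
  | nil =>
    refine ⟨TF, ?_, rfl⟩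
    rw [← tape_head_right₀, hy]
    rfl
  | cons b y ih =>
    have hb : (TF F.outTape).head = some (F.out b) := by
      rw [← tape_head_right₀, hy]
      rfl
    obtain ⟨TF', h1, h2⟩ := ih (M.inp b :: v)
      (Function.update TF F.outTape ((TF F.outTape).move .right)) (by
        rw [Function.update_self, tape_right₀_move_right, hy]
        rfl)
    rw [List.map_cons, List.reverse_cons, List.append_assoc]
    refine ⟨TF', h1, _, comp_step (.copy _ b (by simp [hb])) (by simp) rfl (fun i => ?_)
      (fun i => ?_), h2⟩
    · by_cases hi : i = F.outTape
      · subst hi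
        simp [map_keep, moveTape_some]
      · simp [hi, map_keep, moveTape_none]
    · by_cases hi : i = M.inTape
      · subst hi
        have := map_step (Sum.inr : M.Γ → F.Γ ⊕ M.Γ) (wordTape v []) (some (M.inp b)) (some .right)
        rw [Option.map_some, wordTape_write_nil] at this
        simp only [Function.update_self, or_true, if_true, inputTapes, this]
        simp [moveTape_some, wordTape_move_right]
      · simp [hi, map_keep, moveTape_none, inputTapes]

open Classical in
/-- A step in which only the input tape of `M` moves. -/
theorem comp_step_move {q q' : F.Q ⊕ Unit ⊕ M.Q} {TF : F.ι → Tape (Option F.Γ)}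
    {T : Tape (Option M.Γ)} {d : Dir} (hq : q ≠ .inr (.inr M.halt))
    (h : ∀ r, r = (Sum.elim (fun i => (TF i).head.map Sum.inl)
      fun i => (inputTapes M T i).head.map Sum.inr) →
      CompStep F M q r q' r fun i => if i = .inr M.inTape then some d else none) :
    (M.comp F).Step (compCfg F M q TF (inputTapes M T))
      (compCfg F M q' TF (inputTapes M (T.move d))) := by
  refine comp_step (h _ rfl) hq rfl (fun i => ?_) fun i => ?_
  · simp [map_keep, moveTape_none]
  · by_cases hi : i = M.inTape <;> simp [hi, inputTapes, map_keep, moveTape_none, moveTape_some]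

theorem comp_rewind (v w : List M.Γ) (TF : F.ι → Tape (Option F.Γ)) :
    (M.comp F).ReachesIn (v.length + 1)
      (compCfg F M (.inr (.inl ())) TF (inputTapes M ((wordTape v w).move .left)))
      (compCfg F M (.inr (.inr M.start)) TF (inputTapes M (wordTape [] (v.reverse ++ w)))) := by
  induction v generalizing w with
  | nil =>
    have := comp_step_move (F := F) (M := M) (q := .inr (.inl ())) (q' := .inr (.inr M.start))
      (TF := TF) (T := (wordTape [] w).move .left) (d := .right) (by simp) (by
        rintro r rfl
        refine .launch _ ?_
        simp [inputTapes, wordTape_blank_head])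
    rw [Tape.move_left_right] at this
    exact .of_step this
  | cons a v ih =>
    have := comp_step_move (F := F) (M := M) (q := .inr (.inl ())) (q' := .inr (.inl ()))
      (TF := TF) (T := (wordTape (a :: v) w).move .left) (d := .left) (by simp) (by
        rintro r rfl
        refine .rewind _ ?_
        simp [inputTapes, wordTape_move_left, wordTape_head_cons])
    rw [wordTape_move_left] at this ⊢
    refine ⟨_, this, ?_⟩
    simpa using ih (a :: w)

/-- If `F` outputs `y`, then the composition starts `M` on `y`. -/
theorem comp_launch {x : List α} {n : ℕ} {y : List β} (h : F.OutputsIn x n y) :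
    ∃ TF, (M.comp F).ReachesIn (n + 2 * y.length + 2) ((M.comp F).init x)
      (compCfg F M (.inr (.inr M.start)) TF (M.init y).tape) := by
  obtain ⟨c, hc, hs, hy⟩ := h
  have h1 := comp_reachesIn_first (M := M) hc (inputTapes M (wordTape [] []))
  rw [hs] at h1
  obtain ⟨TF, hTF, h2⟩ := comp_copy (M := M) y [] c.tape hy
  have h3 := comp_step_move (F := F) (M := M) (q := .inl F.halt) (q' := .inr (.inl ()))
    (TF := TF) (T := wordTape ((y.map M.inp).reverse ++ []) []) (d := .left) (by simp) (by
      rintro r rfl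
      refine .turn _ ?_
      simp [hTF])
  have h4 := comp_rewind (F := F) (M := M) ((y.map M.inp).reverse ++ []) [] TF
  refine ⟨TF, ?_⟩
  have := ((h1.trans h2).trans (.of_step h3)).trans h4
  have hlen : ((y.map M.inp).reverse ++ []).length = y.length := by simp
  rw [hlen, show n + y.length + 1 + (y.length + 1) = n + 2 * y.length + 2 by omega] at this
  rw [comp_init, init_tape y]
  simpa [show (F.init x).state = F.start from rfl] using this

/-- From the start of `M` on, the composition does exactly what `M` does. -/
theorem comp_step_second {q : M.Q} {TF : F.ι → Tape (Option F.Γ)} {TM : M.ι → Tape (Option M.Γ)}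
    {e : (M.comp F).Cfg} : (M.comp F).Step (compCfg F M (.inr (.inr q)) TF TM) e ↔
      ∃ c : M.Cfg, M.Step ⟨q, TM⟩ c ∧ e = compCfg F M (.inr (.inr c.state)) TF c.tape := by
  constructor
  · rintro ⟨hq, w, d, hδ, he⟩
    change CompStep F M _ _ _ w d at hδ
    rw [compCfg_heads] at hδ
    obtain ⟨s, T⟩ := e
    simp only [compCfg] at hq hδ
    generalize hr : Sum.elim _ _ = r at hδ
    cases hδ with
    | @second _ q' r w d rF h =>
      have hrM : (fun i => (TM i).head) = r :=
        funext fun i => Option.map_injective Sum.inr_injective (congrFun hr (.inr i))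
      have hrF : ∀ i, (TF i).head.map Sum.inl = rF i :=
        fun i => congrFun hr (.inl i)
      refine ⟨⟨q', fun i => moveTape (d i) ((TM i).write (w i))⟩,
        ⟨fun h => hq (by rw [show q = M.halt from h]), w, d, hrM ▸ h, fun _ => rfl⟩, ?_⟩
      simp only [compCfg, Cfg.mk.injEq, true_and]
      funext i
      refine (he i).trans ?_
      rcases i with i | i
      · simp [compCfg, moveTape_none, ← hrF, map_keep (d := none)]
      · simp only [compCfg, Sum.elim_inr, map_step]
  · rintro ⟨c, ⟨hq, w, d, hδ, hc⟩, rfl⟩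
    refine comp_step (.second _ hδ) (by simpa using hq) rfl (fun i => ?_) fun i => ?_
    · exact (map_keep _ _ none).symm
    · simp only [Sum.elim_inr, map_step, hc]

theorem comp_reachesIn_second {n : ℕ} {c : M.Cfg} {TF : F.ι → Tape (Option F.Γ)}
    {e : (M.comp F).Cfg} :
    (M.comp F).ReachesIn n (compCfg F M (.inr (.inr c.state)) TF c.tape) e ↔
      ∃ d, M.ReachesIn n c d ∧ e = compCfg F M (.inr (.inr d.state)) TF d.tape := by
  induction n generalizing c with
  | zero =>
    constructor
    · rintro rfl
      exact ⟨c, rfl, rfl⟩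
    · rintro ⟨_, rfl, rfl⟩
      rfl
  | succ n ih =>
    constructor
    · rintro ⟨f, hf, h⟩
      obtain ⟨c', hc', rfl⟩ := comp_step_second.1 hf
      obtain ⟨d, hd, rfl⟩ := ih.1 h
      exact ⟨d, ⟨c', hc', hd⟩, rfl⟩
    · rintro ⟨d, ⟨c', hc', hd⟩, rfl⟩
      exact ⟨_, comp_step_second.2 ⟨c', hc', rfl⟩, ih.2 ⟨d, hd, rfl⟩⟩

/-- If `F` outputs `y` on `x` after `n` steps, the composition outputs on `x` what `M` outputs on
`y`, with the delay `n + 2 |y| + 2`. -/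
theorem comp_outputsIn (hF : F.Deterministic) (hM : M.Deterministic) {x : List α} {n k : ℕ}
    {y : List β} (h : F.OutputsIn x n y) {z : List γ} : (M.comp F).OutputsIn x k z ↔
      n + 2 * y.length + 2 ≤ k ∧ M.OutputsIn y (k - (n + 2 * y.length + 2)) z := by
  obtain ⟨TF, hTF⟩ := comp_launch (M := M) h
  have out : ∀ T : Tape (Option M.Γ), (T.map (blankMap (Sum.inr : M.Γ → F.Γ ⊕ M.Γ))).right₀ =
      ListBlank.mk (z.map fun b => some ((M.comp F).out b)) ↔
      T.right₀ = ListBlank.mk (z.map fun b => some (M.out b)) := by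
    intro T
    have hz : ListBlank.mk (z.map fun b => some ((M.comp F).out b)) =
        (ListBlank.mk (z.map fun b => some (M.out b))).map (blankMap Sum.inr) := by
      rw [ListBlank.map_mk, List.map_map]
      rfl
    rw [hz, right₀_map]
    exact ⟨fun h => listBlank_map_injective Sum.inr_injective h, fun h => by rw [h]⟩
  constructor
  · rintro ⟨e, he, hs, hz⟩
    rcases ((hF.comp hM).forced hTF).split he with ⟨-, h⟩ | ⟨h, h'⟩
    · exact absurd hs h
    · obtain ⟨d, hd, rfl⟩ := comp_reachesIn_second (c := M.init y).1 h'
      exact ⟨h, d, hd, by simpa [compCfg] using hs, (out _).1 hz⟩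
  · rintro ⟨hk, d, hd, hs, hz⟩
    have := hTF.trans (comp_reachesIn_second (c := M.init y).2 ⟨d, hd, rfl⟩)
    rw [Nat.add_sub_cancel' hk] at this
    exact ⟨_, this, by simp [compCfg, hs], (out _).2 hz⟩

variable {M : MTM β Bool}

theorem comp_answersIn (hF : F.Deterministic) (hM : M.Deterministic) {x : List α} {n k : ℕ}
    {y : List β} (h : F.OutputsIn x n y) {b : Bool} : (M.comp F).AnswersIn x k b ↔
      n + 2 * y.length + 2 ≤ k ∧ M.AnswersIn y (k - (n + 2 * y.length + 2)) b := by
  simp only [AnswersIn, comp_outputsIn hF hM h, exists_and_left]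

theorem comp_time_le (hF : F.Deterministic) (hM : M.Deterministic) {x : List α} {n : ℕ}
    {y : List β} (h : F.OutputsIn x n y) :
    (M.comp F).time x ≤ (n + 2 * y.length + 2 : ℕ) + M.time y := by
  by_cases ht : M.time y = ⊤
  · simp [ht]
  · obtain ⟨k, b, hk, hkt⟩ : ∃ (k : ℕ) (b : Bool), M.AnswersIn y k b ∧ (k : ℕ∞) = M.time y := by
      obtain ⟨k, hk⟩ := ENat.exists_eq_iInf fun n : ℕ =>
        ⨅ _ : ∃ b, M.AnswersIn y n b, (n : ℕ∞)
      change _ = M.time y at hk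
      by_cases hb : ∃ b, M.AnswersIn y k b
      · rw [iInf_pos hb] at hk
        exact ⟨k, hb.choose, hb.choose_spec, hk⟩
      · rw [iInf_neg hb] at hk
        exact absurd hk.symm ht
    rw [← hkt, ← Nat.cast_add]
    refine iInf₂_le (n + 2 * y.length + 2 + k) ⟨b, (comp_answersIn hF hM h).2 ⟨by omega, ?_⟩⟩
    rwa [Nat.add_sub_cancel_left]

end MTM

/-! ### The identity reduction -/

/-- The machine that halts at once, its input tape being its output tape. -/
def idMachine (α : Type) [Finite α] : MTM α α where
  ι := Unit
  inTape := ()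
  outTape := ()
  Γ := α
  inp := .refl _
  out := .refl _
  Q := Unit
  start := ()
  halt := ()
  δ _ _ _ _ _ := False

theorem idMachine_computes (α : Type) [Finite α] : (idMachine α).ComputesInPolyTime id := by
  refine ⟨fun _ _ _ _ _ _ _ _ h => h.elim, 0, fun x => ⟨0, Nat.zero_le _, _, rfl, rfl, ?_⟩⟩
  simp only [MTM.init, idMachine, Tape.mk₁, Tape.mk₂, id, if_true]
  exact Tape.mk'_right₀ _ _

/-- Running a polynomial time machine for the identity before `A` costs polynomial time, and passing
from the ensemble of `DBH(M)` to that of `DBH(M, g)` costs a linear factor in the measure. -/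
theorem comp_sgptimeDecides {M : NTM Bool} {g : ℕ → ℕ} (hg : StrictMono g)
    {F : MTM Bool Bool} (hF : F.ComputesInPolyTime id) {A : MTM Bool Bool}
    (hA : SGPtimeDecides A (DBH M)) : SGPtimeDecides (A.comp F) (restrictedDBH M g) := by
  obtain ⟨hFd, pF, hF⟩ := hF
  obtain ⟨⟨hAd, hA⟩, p, hp⟩ := hA
  refine ⟨⟨hFd.comp hAd, fun x k b h => ?_⟩, pF + 2 * Polynomial.X + 2 + p, fun q hq => ?_⟩
  · obtain ⟨n, -, hn⟩ := hF x
    exact hA x _ b ((MTM.comp_answersIn hFd hAd hn).1 h).2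
  · -- The induced ensemble costs at most a factor `n + 1`, which the bound for `q (n + 1)` absorbs.
    have h := hp (q * (Polynomial.X + 1)) (mul_ne_zero hq (Polynomial.X_add_C_ne_zero 1))
    have h' := (isBigO_refl (fun n : ℕ => (n : ℝ) + 1) atTop).mul_isLittleO h
    have e : (fun n : ℕ => ((n : ℝ) + 1) * (1 / (((q * (Polynomial.X + 1)).eval n : ℕ) : ℝ))) =
        fun n => 1 / ((q.eval n : ℕ) : ℝ) := by
      funext n
      have : (n : ℝ) + 1 ≠ 0 := by positivity
      simp only [Polynomial.eval_mul, Polynomial.eval_add, Polynomial.eval_X, Polynomial.eval_one,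
        Nat.cast_mul, Nat.cast_add, Nat.cast_one]
      by_cases h0 : ((q.eval n : ℕ) : ℝ) = 0
      · simp [h0]
      · field_simp
    rw [e] at h'
    refine IsBigO.trans_isLittleO (IsBigO.of_bound 1 (.of_forall fun n => ?_)) h'
    rw [one_mul, Real.norm_of_nonneg, Real.norm_of_nonneg]
    · refine (induced_measure_le hg n _).trans ?_
      refine mul_le_mul_of_nonneg_left ?_ (by positivity)
      refine sphereSum_mono_set haltingEnsemble.nonneg fun x hx hxS => ?_
      obtain ⟨k, hk, hkx⟩ := hF x
      have ht := lt_of_lt_of_le hxS (MTM.comp_time_le hFd hAd hkx)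
      rw [hx] at hk
      simp only [id, hx] at ht
      by_contra hpn
      simp only [Set.mem_ofPred_eq, not_lt] at hpn
      refine absurd (ht.trans_le (add_le_add le_rfl hpn)) ?_
      rw [← Nat.cast_add, Nat.cast_lt, not_lt]
      simp only [Polynomial.eval_add, Polynomial.eval_mul, Polynomial.eval_ofNat,
        Polynomial.eval_X]
      omega
    · exact mul_nonneg (by positivity) (Finset.sum_nonneg fun v _ =>
        Set.indicator_nonneg (fun z _ => (DBH M).μ.nonneg z) _)
    · exact Finset.sum_nonneg fun v _ =>
        Set.indicator_nonneg (fun z _ => (restrictedDBH M g).μ.nonneg z) _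

end GenericNP

end

theorem mainTheorem6 (M : GenericNP.NTM Bool) (g : ℕ → ℕ)
    (hg_poly : ∃ p : Polynomial ℝ, ∀ n : ℕ, (g n : ℝ) = p.eval (n : ℝ))
    (hg_le : ∀ n, n ≤ g n) (hg_mono : StrictMono g) :
    GenericNP.InDistNP (GenericNP.restrictedDBH M g) ∧
      GenericNP.IsSGPtimeReduction id (GenericNP.restrictedDBH M g) (GenericNP.DBH M) := by
  have h := GenericNP.restrictedDBH_inDistNP M hg_poly hg_mono
  exact ⟨h, h, GenericNP.DBH_inDistNP M,
    ⟨⟨_, GenericNP.idMachine_computes Bool⟩, fun _ => Iff.rfl, fun _ _ => Iff.rfl⟩,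
    fun _ hF _ hA => GenericNP.comp_sgptimeDecides hg_mono hF hA⟩
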